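/- Let HTop be the category of topological spaces and homotopy classes of continuous maps (H-maps), let HPol be its full subcategory of spaces with the homotopy type of a polyhedron (the realization $|K|$ of a simplicial complex $K$ with the weak topology), and let $\mathrm{Sh}$ be the shape category $\mathrm{Sh}_{(\mathrm{HTop},\mathrm{HPol})}$: a shape morphism $F\colon X\to Y$ is a class of pro-morphisms $\mathbf f\colon\mathbf X\to\mathbf Y$ between HPol-expansions $\mathbf p\colon X\to\mathbf X$ and $\mathbf q\colon Y\to\mathbf Y$, where two pro-morphisms are identified if they correspond to each other under the canonical isomorphisms of the expansions. The shape functor $S\colon \mathrm{HTop}\to\mathrm{Sh}$ sends an H-map $f$ to the class of the $\mathbf f$ with $\mathbf f\circ\mathbf p=\mathbf q\circ f$. For an integer $n\ge 0$, a space $Z$ has $\operatorname{sd}Z\le n$ if it has an HPol-expansion $Z\to(Z_\lambda)$ in which every $Z_\lambda$ is homotopy dominated by a polyhedron of dimension $\le n$. A morphism of inverse systems $(f_\mu,\phi)\colon (X_\lambda,p_{\lambda\lambda'},\Lambda)\to(Y_\mu,q_{\mu\mu'},M)$ in HPol has dimension $\le n$ if for every $\mu\in M$ there is $\lambda\ge\phi(\mu)$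 such that $f_\mu\circ p_{\phi(\mu)\lambda}\colon X_\lambda\to Y_\mu$ factors in HPol through a polyhedron of dimension $\le n$; a pro-morphism has dimension $\le n$ if some morphism of inverse systems representing it does. A shape morphism $F$ has $\operatorname{sd}F\le n$ if it is represented by a pro-morphism of dimension $\le n$ between HPol-expansions. For a continuous map $f$, $\operatorname{sd}f\le n$ means $\operatorname{sd}S([f])\le n$, and $\operatorname{sd}f=n$ means that $n$ is the least integer $m\ge 0$ with $\operatorname{sd}f\le m$. Let $X$ and $Y$ be arbitrary topological spaces and $n\ge 0$ an integer. (1) If a shape morphism $F\colon X\to Y$ factors in $\mathrm{Sh}$ as $F=H\circ G$ with shape morphisms $G\colon X\to Z$ and $H\colon Z\to Y$ through a topological space $Z$ with $\operatorname{sd}Z\le n$, then $\operatorname{sd}F\le n$. (2) In particular, if a continuous map $f\colon X\to Y$ is a composite of continuous maps $X\to Z\to Y$ with $\operatorname{sd}Z\le n$, then $\operatorname{sd}f\le n$. (3) If a continuous map $f\colon X\to Y$ is nullhomotopic (homotopic to a constant map with value a point of $Y$), then $\operatorname{sd}f=0$. -/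

import Mathlib

open CategoryTheory

universe u v w

/-! ## Inverse systems and the pro-category -/

/-- An inverse system in `C`, indexed by a (nonempty) directed preordered set:
`map : X_j ⟶ X_i` is the bonding morphism for `i ≤ j`. -/
structure InvSystem (C : Type u) [Category.{v} C] where
  Idx : Type w
  [pre : Preorder Idx]
  [dir : IsDirectedOrder Idx]
  [ne : Nonempty Idx]
  obj : Idx → C
  map : ∀ {i j : Idx}, i ≤ j → (obj j ⟶ obj i)
  map_refl : ∀ i : Idx, map (le_refl i) = 𝟙 (obj i)
  map_trans : ∀ {i j k : Idx} (hij : i ≤ j) (hjk : j ≤ k),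
    map hjk ≫ map hij = map (hij.trans hjk)

attribute [instance] InvSystem.pre InvSystem.dir InvSystem.ne
attribute [simp] InvSystem.map_refl InvSystem.map_trans

namespace InvSystem

variable {C : Type u} [Category.{v} C]

@[simp]
theorem map_trans_assoc (X : InvSystem.{u, v, w} C) {i j k : X.Idx} (hij : i ≤ j) (hjk : j ≤ k)
    {T : C} (t : X.obj i ⟶ T) :
    X.map hjk ≫ X.map hij ≫ t = X.map (hij.trans hjk) ≫ t := by
  rw [← Category.assoc, map_trans]

/-- A morphism of inverse systems `(f_μ, φ) : X → Y`: an index function `φ` and morphisms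
`f_μ : X_{φ(μ)} ⟶ Y_μ` such that for `μ ≤ μ'` the evident square commutes after passing to some
`l ≥ φ(μ), φ(μ')`. -/
structure SysHom (X Y : InvSystem.{u, v, w} C) where
  idx : Y.Idx → X.Idx
  app : ∀ m : Y.Idx, X.obj (idx m) ⟶ Y.obj m
  comm : ∀ {m m' : Y.Idx} (h : m ≤ m'), ∃ (l : X.Idx) (h₁ : idx m ≤ l) (h₂ : idx m' ≤ l),
    X.map h₁ ≫ app m = X.map h₂ ≫ app m' ≫ Y.map h

namespace SysHom

variable {X Y Z : InvSystem.{u, v, w} C}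

/-- Equivalence of morphisms of inverse systems. -/
def Equiv (f g : SysHom X Y) : Prop :=
  ∀ m : Y.Idx, ∃ (l : X.Idx) (h₁ : f.idx m ≤ l) (h₂ : g.idx m ≤ l),
    X.map h₁ ≫ f.app m = X.map h₂ ≫ g.app m

/-- An equality of two morphisms out of terms of the system persists at later indices. -/
theorem eq_later {i j l k : X.Idx} {T : C} {a : X.obj i ⟶ T} {b : X.obj j ⟶ T}
    {hi : i ≤ l} {hj : j ≤ l} (e : X.map hi ≫ a = X.map hj ≫ b) (h : l ≤ k) :
    X.map (hi.trans h) ≫ a = X.map (hj.trans h) ≫ b := by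
  rw [← X.map_trans_assoc hi h, ← X.map_trans_assoc hj h, e]

instance setoid (X Y : InvSystem.{u, v, w} C) : Setoid (SysHom X Y) where
  r := Equiv
  iseqv :=
    { refl := fun f m => ⟨f.idx m, le_refl _, le_refl _, rfl⟩
      symm := fun h m => by
        obtain ⟨l, h₁, h₂, e⟩ := h m
        exact ⟨l, h₂, h₁, e.symm⟩
      trans := fun h h' m => by
        obtain ⟨l, h₁, h₂, e⟩ := h m
        obtain ⟨l', h₁', h₂', e'⟩ := h' m
        obtain ⟨k, hk, hk'⟩ := exists_ge_ge l l'
        exact ⟨k, h₁.trans hk, h₂'.trans hk', (eq_later e hk).trans (eq_later e' hk')⟩ }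

/-- The identity morphism of an inverse system. -/
def id (X : InvSystem.{u, v, w} C) : SysHom X X where
  idx m := m
  app m := 𝟙 _
  comm {m m'} h := ⟨m', h, le_refl _, by simp⟩

/-- The composite of morphisms of inverse systems. -/
def comp (f : SysHom X Y) (g : SysHom Y Z) : SysHom X Z where
  idx n := f.idx (g.idx n)
  app n := f.app (g.idx n) ≫ g.app n
  comm {n n'} h := by
    obtain ⟨m, h₁, h₂, e⟩ := g.comm h
    obtain ⟨l₁, a₁, b₁, e₁⟩ := f.comm h₁
    obtain ⟨l₂, a₂, b₂, e₂⟩ := f.comm h₂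
    obtain ⟨l, k₁, k₂⟩ := exists_ge_ge l₁ l₂
    refine ⟨l, a₁.trans k₁, a₂.trans k₂, ?_⟩
    have E₁ := eq_later (b := f.app m ≫ Y.map h₁) e₁ k₁
    have E₂ := eq_later (b := f.app m ≫ Y.map h₂) e₂ k₂
    calc X.map (a₁.trans k₁) ≫ f.app (g.idx n) ≫ g.app n
        = X.map (b₁.trans k₁) ≫ f.app m ≫ Y.map h₁ ≫ g.app n := by
          rw [← Category.assoc, E₁]; simp
      _ = (X.map (b₂.trans k₂) ≫ f.app m ≫ Y.map h₂) ≫ g.app n' ≫ Z.map h := by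
          rw [e]; simp
      _ = X.map (a₂.trans k₂) ≫ (f.app (g.idx n') ≫ g.app n') ≫ Z.map h := by
          rw [← E₂]; simp

theorem comp_congr {f f' : SysHom X Y} {g g' : SysHom Y Z} (hf : Equiv f f') (hg : Equiv g g') :
    Equiv (f.comp g) (f'.comp g') := by
  intro n
  obtain ⟨m, h₁, h₂, e⟩ := hg n
  obtain ⟨l₁, a₁, b₁, e₁⟩ := f.comm h₁
  obtain ⟨l₂, a₂, b₂, e₂⟩ := f.comm h₂
  obtain ⟨l₃, a₃, b₃, e₃⟩ := hf (g'.idx n)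
  obtain ⟨k, k₁, k₂⟩ := exists_ge_ge l₁ l₂
  obtain ⟨l, hk, k₃⟩ := exists_ge_ge k l₃
  have E₁ := eq_later (b := f.app m ≫ Y.map h₁) e₁ (k₁.trans hk)
  have E₂ := eq_later (b := f.app m ≫ Y.map h₂) e₂ (k₂.trans hk)
  have E₃ := eq_later e₃ k₃
  refine ⟨l, a₁.trans (k₁.trans hk), b₃.trans k₃, ?_⟩
  calc X.map (a₁.trans (k₁.trans hk)) ≫ f.app (g.idx n) ≫ g.app n
      = X.map (b₁.trans (k₁.trans hk)) ≫ f.app m ≫ Y.map h₁ ≫ g.app n := by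
        rw [← Category.assoc, E₁]; simp
    _ = (X.map (b₂.trans (k₂.trans hk)) ≫ f.app m ≫ Y.map h₂) ≫ g'.app n := by
        rw [e]; simp
    _ = (X.map (a₃.trans k₃) ≫ f.app (g'.idx n)) ≫ g'.app n := by rw [← E₂]
    _ = X.map (b₃.trans k₃) ≫ f'.app (g'.idx n) ≫ g'.app n := by rw [E₃]; simp

end SysHom

/-- The category pro-`C`: objects are inverse systems, morphisms are equivalence classes of
morphisms of inverse systems. -/
instance : Category (InvSystem.{u, v, w} C) where
  Hom X Y := _root_.Quotient (SysHom.setoid X Y)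
  id X := _root_.Quotient.mk _ (SysHom.id X)
  comp f g := _root_.Quotient.map₂ SysHom.comp
    (fun _ _ hf _ _ hg => SysHom.comp_congr hf hg) f g
  id_comp := by
    rintro X Y ⟨f⟩
    exact _root_.Quotient.sound fun m => ⟨f.idx m, le_refl _, le_refl _, by
      simp [SysHom.comp, SysHom.id]⟩
  comp_id := by
    rintro X Y ⟨f⟩
    exact _root_.Quotient.sound fun m => ⟨f.idx m, le_refl _, le_refl _, by
      simp [SysHom.comp, SysHom.id]⟩
  assoc := by
    rintro X Y Z W ⟨f⟩ ⟨g⟩ ⟨h⟩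
    exact _root_.Quotient.sound fun m => ⟨f.idx (g.idx (h.idx m)), le_refl _, le_refl _, by
      simp [SysHom.comp]⟩

/-- The pro-morphism represented by a morphism of inverse systems. -/
def SysHom.toPro {X Y : InvSystem.{u, v, w} C} (f : SysHom X Y) : X ⟶ Y :=
  _root_.Quotient.mk _ f

/-- An object of `C` as a system indexed by one point. -/
def single (X : C) : InvSystem.{u, v, w} C where
  Idx := PUnit
  obj _ := X
  map _ := 𝟙 X
  map_refl _ := rfl
  map_trans _ _ := Category.comp_id _

/-- A morphism of `C` as a pro-morphism between one-point systems. -/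
def singleMap {X Y : C} (f : X ⟶ Y) : (single X : InvSystem.{u, v, w} C) ⟶ single Y :=
  SysHom.toPro
    { idx := fun _ => PUnit.unit
      app := fun _ => f
      comm := fun _ => ⟨PUnit.unit, le_refl _, le_refl _, by simp [single]⟩ }

end InvSystem

/-! ## Polyhedra -/

/-- The points of the polyhedron `|K|`, in barycentric coordinates. -/
def Polyhedron {V : Type u} (K : PreAbstractSimplicialComplex V) : Type u :=
  {t : V → ℝ // (∀ x, 0 ≤ t x) ∧ ∃ s ∈ K.faces, (∀ x, x ∉ s → t x = 0) ∧ ∑ x ∈ s, t x = 1}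

/-- The closed simplex of `|K|` spanned by a set `s` of vertices. -/
def Polyhedron.simplex {V : Type u} (K : PreAbstractSimplicialComplex V) (s : Finset V) :
    Set (Polyhedron K) :=
  {t | ∀ x, x ∉ s → t.1 x = 0}

/-- The weak (CW) topology: the finest topology on `|K|` for which the inclusions of the closed
simplices, with their Euclidean topology, are continuous. -/
instance {V : Type u} (K : PreAbstractSimplicialComplex V) : TopologicalSpace (Polyhedron K) :=
  ⨆ s : K.faces, TopologicalSpace.coinduced
    (Subtype.val : Polyhedron.simplex K (s : Finset V) → Polyhedron K)
    (TopologicalSpace.induced (fun t => (t.1.1 : V → ℝ)) inferInstance)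

/-- `dim K ≤ n`: every simplex of `K` has at most `n + 1` vertices. -/
def PreAbstractSimplicialComplex.DimLE {V : Type u} (K : PreAbstractSimplicialComplex V)
    (n : ℕ) : Prop :=
  ∀ s ∈ K.faces, s.card ≤ n + 1

/-! ## The homotopy category -/

/-- The homotopy relation on continuous maps. -/
def homotopyRel : HomRel TopCat.{u} := fun _ _ f g => f.hom.Homotopic g.hom

/-- HTop: topological spaces and homotopy classes of continuous maps (H-maps). -/
abbrev HTop : Type (u + 1) := CategoryTheory.Quotient homotopyRel.{u}

/-- The functor sending a continuous map to its homotopy class. -/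
abbrev toHTop : TopCat.{u} ⥤ HTop.{u} := CategoryTheory.Quotient.functor homotopyRel.{u}

/-- A polyhedron as an object of HTop. -/
def hPoly {V : Type u} (K : PreAbstractSimplicialComplex V) : HTop.{u} :=
  toHTop.obj (TopCat.of (Polyhedron K))

/-- `X` is an object of HPol: it has the homotopy type of a polyhedron. -/
def IsHPol (X : HTop.{u}) : Prop :=
  ∃ (V : Type u) (K : PreAbstractSimplicialComplex V), Nonempty (X ≅ hPoly K)

/-- `X` is homotopy dominated by a polyhedron of dimension `≤ n`. -/
def DominatedDimLE (X : HTop.{u}) (n : ℕ) : Prop :=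
  ∃ (V : Type u) (K : PreAbstractSimplicialComplex V), K.DimLE n ∧
    ∃ (i : X ⟶ hPoly K) (r : hPoly K ⟶ X), i ≫ r = 𝟙 X

/-- An H-map factors through a polyhedron of dimension `≤ n`. -/
def FactorsDimLE {X Y : HTop.{u}} (f : X ⟶ Y) (n : ℕ) : Prop :=
  ∃ (V : Type u) (K : PreAbstractSimplicialComplex V), K.DimLE n ∧
    ∃ (a : X ⟶ hPoly K) (b : hPoly K ⟶ Y), f = a ≫ b

/-! ## Dimension of systems and of their morphisms -/

/-- Inverse systems of spaces in HTop, indexed by sets of the same size as the spaces. -/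
abbrev HSystem : Type (u + 1) := InvSystem.{u + 1, u, u} HTop.{u}

/-- The system lies in pro-HPol. -/
def InPolSystem (X : HSystem.{u}) : Prop := ∀ l : X.Idx, IsHPol (X.obj l)

/-- `dim X ≤ n` for an inverse system `X`. -/
def SystemDimLE (X : HSystem.{u}) (n : ℕ) : Prop := ∀ l : X.Idx, DominatedDimLE (X.obj l) n

/-- `dim (f_μ, φ) ≤ n`: every `μ` admits `l ≥ φ(μ)` such that `X_l ⟶ X_{φ(μ)} ⟶ Y_μ` factors
through a polyhedron of dimension `≤ n`. -/
def SysHomDimLE {X Y : HSystem.{u}} (f : InvSystem.SysHom X Y) (n : ℕ) : Prop :=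
  ∀ m : Y.Idx, ∃ (l : X.Idx) (h : f.idx m ≤ l), FactorsDimLE (X.map h ≫ f.app m) n

/-- `dim f ≤ n` for a pro-morphism: some representing morphism of systems has dimension `≤ n`. -/
def ProHomDimLE {X Y : HSystem.{u}} (f : X ⟶ Y) (n : ℕ) : Prop :=
  ∃ g : InvSystem.SysHom X Y, g.toPro = f ∧ SysHomDimLE g n

/-! ## Expansions and the shape category -/

/-- An HPol-expansion `p : X ⟶ sys` of the space `X`: a pro-morphism into a system in pro-HPol
through which every pro-morphism from `X` into a system in pro-HPol factors uniquely. -/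
structure HPolExpansion (X : TopCat.{u}) where
  sys : HSystem.{u}
  inPol : InPolSystem sys
  p : InvSystem.single (toHTop.obj X) ⟶ sys
  univ : ∀ (Y : HSystem.{u}), InPolSystem Y → ∀ h : InvSystem.single (toHTop.obj X) ⟶ Y,
    ∃! f : sys ⟶ Y, p ≫ f = h

namespace HPolExpansion

variable {X : TopCat.{u}}

/-- The canonical pro-morphism between two HPol-expansions of `X`. -/
noncomputable def can (a b : HPolExpansion X) : a.sys ⟶ b.sys :=
  (a.univ b.sys b.inPol b.p).choose

theorem p_can (a b : HPolExpansion X) : a.p ≫ a.can b = b.p :=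
  (a.univ b.sys b.inPol b.p).choose_spec.1

theorem hom_ext (a : HPolExpansion X) {Y : HSystem.{u}} (hY : InPolSystem Y) {f g : a.sys ⟶ Y}
    (h : a.p ≫ f = a.p ≫ g) : f = g :=
  (a.univ Y hY (a.p ≫ g)).unique h rfl

theorem can_self (a : HPolExpansion X) : a.can a = 𝟙 a.sys :=
  a.hom_ext a.inPol (by rw [p_can, Category.comp_id])

theorem can_can (a b c : HPolExpansion X) : a.can b ≫ b.can c = a.can c :=
  a.hom_ext c.inPol (by rw [← Category.assoc, p_can, p_can, p_can])

end HPolExpansion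

/-- A pro-morphism between HPol-expansions of `X` and `Y`. -/
structure ShapeRep (X Y : TopCat.{u}) where
  dom : HPolExpansion X
  cod : HPolExpansion Y
  hom : dom.sys ⟶ cod.sys

/-- Two pro-morphisms between expansions are equivalent if they correspond to each other under
the canonical isomorphisms of the expansions. -/
def ShapeRep.Equiv {X Y : TopCat.{u}} (r s : ShapeRep X Y) : Prop :=
  r.hom ≫ r.cod.can s.cod = r.dom.can s.dom ≫ s.hom

instance ShapeRep.setoid (X Y : TopCat.{u}) : Setoid (ShapeRep X Y) where
  r := ShapeRep.Equiv
  iseqv :=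
    { refl := fun r => by
        simp [ShapeRep.Equiv, HPolExpansion.can_self]
      symm := fun {r s} h => by
        unfold ShapeRep.Equiv at *
        have h' := congrArg (fun k => s.dom.can r.dom ≫ k ≫ s.cod.can r.cod) h
        simpa only [Category.assoc, HPolExpansion.can_can, HPolExpansion.can_self,
          Category.comp_id, ← Category.assoc (s.dom.can r.dom) (r.dom.can s.dom),
          Category.id_comp] using h'.symm
      trans := fun {r s t} h h' => by
        unfold ShapeRep.Equiv at *
        rw [← HPolExpansion.can_can r.cod s.cod t.cod, ← Category.assoc, h, Category.assoc, h',
          ← Category.assoc, HPolExpansion.can_can] }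

/-- Shape morphisms `X → Y`. -/
def ShapeHom (X Y : TopCat.{u}) : Type (u + 1) := _root_.Quotient (ShapeRep.setoid X Y)

namespace ShapeHom

variable {X Y Z : TopCat.{u}}

/-- The shape morphism represented by a pro-morphism between expansions. -/
def mk (r : ShapeRep X Y) : ShapeHom X Y := _root_.Quotient.mk _ r

/-- Composition in the shape category (in diagrammatic order: first `F`, then `G`). -/
noncomputable def comp (F : ShapeHom X Y) (G : ShapeHom Y Z) : ShapeHom X Z :=
  _root_.Quotient.map₂
    (fun r s => ShapeRep.mk r.dom s.cod (r.hom ≫ r.cod.can s.dom ≫ s.hom))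
    (fun r r' hr s s' hs => by
      have hr : r.hom ≫ r.cod.can r'.cod = r.dom.can r'.dom ≫ r'.hom := hr
      have hs : s.hom ≫ s.cod.can s'.cod = s.dom.can s'.dom ≫ s'.hom := hs
      change (r.hom ≫ r.cod.can s.dom ≫ s.hom) ≫ s.cod.can s'.cod =
        r.dom.can r'.dom ≫ r'.hom ≫ r'.cod.can s'.dom ≫ s'.hom
      rw [← Category.assoc (r.dom.can r'.dom), ← hr]
      simp only [Category.assoc]
      rw [hs, ← Category.assoc (r.cod.can s.dom), HPolExpansion.can_can,
        ← Category.assoc (r.cod.can r'.cod), HPolExpansion.can_can])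
    F G

end ShapeHom

/-- `F` is the image of the H-map `f` under the shape functor: it is represented by a pro-morphism
`g` between expansions `p`, `q` of `X`, `Y` with `g ∘ p = q ∘ f`. -/
def IsShapeImage {X Y : TopCat.{u}} (f : toHTop.obj X ⟶ toHTop.obj Y) (F : ShapeHom X Y) : Prop :=
  ∃ r : ShapeRep X Y, ShapeHom.mk r = F ∧ r.dom.p ≫ r.hom = InvSystem.singleMap f ≫ r.cod.p

/-! ## Shape dimension -/

/-- `sd X ≤ n` for a space `X`: it has an HPol-expansion of dimension `≤ n`. -/
def SpaceSdLE (X : TopCat.{u}) (n : ℕ) : Prop :=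
  ∃ a : HPolExpansion X, SystemDimLE a.sys n

/-- `sd F ≤ n` for a shape morphism `F`: some representation of `F` has dimension `≤ n`. -/
def ShapeSdLE {X Y : TopCat.{u}} (F : ShapeHom X Y) (n : ℕ) : Prop :=
  ∃ r : ShapeRep X Y, ShapeHom.mk r = F ∧ ProHomDimLE r.hom n

/-- `sd f ≤ n` for an H-map `f`: its image under the shape functor exists and has
shape dimension `≤ n`. -/
def HMapSdLE {X Y : TopCat.{u}} (f : toHTop.obj X ⟶ toHTop.obj Y) (n : ℕ) : Prop :=
  ∃ F : ShapeHom X Y, IsShapeImage f F ∧ ShapeSdLE F n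

/-- `sd f ≤ n` for a continuous map `f`. -/
def MapSdLE {X Y : TopCat.{u}} (f : X ⟶ Y) (n : ℕ) : Prop :=
  HMapSdLE (toHTop.map f) n

/-- `sd f = n` for a continuous map `f`: `n` is the least `m` with `sd f ≤ m`. -/
def MapSdEq {X Y : TopCat.{u}} (f : X ⟶ Y) (n : ℕ) : Prop :=
  IsLeast {m : ℕ | MapSdLE f m} n

/-! The dimension estimate itself is formal. A shape morphism through `Z` can be rerouted, by the
canonical isomorphisms between expansions, through an expansion of `Z` whose terms are dominated by
polyhedra of dimension `≤ n`. Each component of the composite then factors through one of these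
polyhedra (`ProHomDimLE.of_systemDimLE`, `ShapeSdLE.comp`). For maps the same argument is applied to
shape images, and a nullhomotopic map factors in HTop through a point, which has shape dimension
`0`.

The substance is that shape images exist, that is, that every space has an HPol-expansion
(`HPolExpansion.nonempty`). This rests on one geometric fact, `exists_nerve`: two maps from `X` into
polyhedra factor up to homotopy through one polyhedron with vertices in `X`, on which two maps that
agree after composition with the first given map already agree. The bound on the vertex set keeps
the category of H-maps from `X` into polyhedra small, and the rest makes it filtered. A directed set
with a final functor to this category indexes the expansion.

Since `X` is arbitrary, partitions of unity are not available on it. The coordinates of all maps and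
of the homotopy involved define a continuous map of `X` into a metric space, and a partition of
unity on the image gives the map to a nerve. Maps out of the nerve come from `blend`, a weighted
minimum instead of a convex combination, so that supports stay inside simplices. The weak topology
is handled by cone families (`IsConeMap`): cutting coordinates off at half the largest one makes
such a family locally finite, hence continuous into the polyhedron, and families with a common
vertex at every point are homotopic (`IsConeMap.homotopic_of_common`). -/

open Filter Topology

/-! ### Continuity into and out of a polyhedron with the weak topology -/

namespace Polyhedron

variable {V : Type u} {K : PreAbstractSimplicialComplex V} {T : Type v} [TopologicalSpace T]

theorem sum_le_one (t : Polyhedron K) (F : Finset V) : ∑ v ∈ F, t.1 v ≤ 1 := by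
  classical
  obtain ⟨s, -, hs, h1⟩ := t.2.2
  calc ∑ v ∈ F, t.1 v ≤ ∑ v ∈ F ∪ s, t.1 v :=
        Finset.sum_le_sum_of_subset_of_nonneg Finset.subset_union_left fun v _ _ => t.2.1 v
    _ = ∑ v ∈ s, t.1 v :=
        (Finset.sum_subset Finset.subset_union_right fun v _ hv => hs v hv).symm
    _ = 1 := h1

theorem le_one (t : Polyhedron K) (v : V) : t.1 v ≤ 1 := by
  simpa using sum_le_one t {v}

theorem exists_pos (t : Polyhedron K) : ∃ v, 0 < t.1 v := by
  obtain ⟨s, -, -, h1⟩ := t.2.2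
  by_contra! h
  have : ∑ v ∈ s, t.1 v ≤ 0 := Finset.sum_nonpos fun v _ => h v
  linarith

theorem sum_eq_one_of_mem_simplex {t : Polyhedron K} {s : Finset V} (h : t ∈ simplex K s) :
    ∑ v ∈ s, t.1 v = 1 := by
  classical
  obtain ⟨s', -, hs, h1⟩ := t.2.2
  exact ((Finset.sum_subset (Finset.subset_union_left (s₂ := s')) fun v _ hv => h v hv).trans
    (Finset.sum_subset (Finset.subset_union_right (s₁ := s)) fun v _ hv => hs v hv).symm).trans h1

/-- The trace of a weakly open set on a closed simplex is Euclidean open, so inside a single simplex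
continuity is a matter of coordinates. -/
theorem continuous_of_mem_simplex {s : Finset V} (hs : s ∈ K.faces) {h : T → Polyhedron K}
    (hh : ∀ y, h y ∈ simplex K s) (hc : ∀ v, Continuous fun y => (h y).1 v) : Continuous h := by
  rw [continuous_def]
  intro O hO
  have h1 := isOpen_coinduced.1 (isOpen_iSup_iff.1 hO ⟨s, hs⟩)
  obtain ⟨O', hO', e⟩ := h1
  have h2 : h ⁻¹' O = (fun y => (h y).1) ⁻¹' O' := by
    ext y
    exact (Set.ext_iff.1 e ⟨h y, hh y⟩).symm
  rw [h2]
  exact hO'.preimage (continuous_pi hc)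

/-- The standard closed simplex on the vertex set `s`, with its Euclidean topology. -/
abbrev StdFace (s : Finset V) : Type u :=
  {a : V → ℝ // (∀ x, 0 ≤ a x) ∧ (∀ x, x ∉ s → a x = 0) ∧ ∑ x ∈ s, a x = 1}

/-- The characteristic map of a closed simplex. -/
def ofFace {s : Finset V} (hs : s ∈ K.faces) (a : StdFace s) : Polyhedron K :=
  ⟨a.1, a.2.1, s, hs, a.2.2⟩

/-- The universal property of the weak topology, with the closed simplices replaced by standard ones
that carry their ordinary subspace topology. -/
theorem continuous_dom {Z : Type w} [TopologicalSpace Z] {f : Polyhedron K → Z}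
    (hf : ∀ (s : Finset V) (hs : s ∈ K.faces), Continuous fun a => f (ofFace hs a)) :
    Continuous f := by
  refine continuous_iSup_dom.2 ?_
  rintro ⟨s, hs⟩
  refine continuous_coinduced_dom.2 ?_
  let e : simplex K s → StdFace s :=
    fun t => ⟨t.1.1, t.1.2.1, t.2, sum_eq_one_of_mem_simplex t.2⟩
  have he : Continuous[TopologicalSpace.induced (fun t : simplex K s => (t.1.1 : V → ℝ))
      inferInstance, inferInstance] e := by
    rw [continuous_induced_rng]
    exact continuous_induced_dom
  exact @Continuous.comp _ _ _ (_) _ _ e _ (hf s hs) he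

theorem continuous_coord (v : V) : Continuous fun t : Polyhedron K => t.1 v :=
  continuous_dom fun _ _ => (continuous_apply v).comp continuous_subtype_val

/-- Near every point only finitely many barycentric coordinates of `h` do not vanish. -/
theorem continuous_of_locallyFinite {h : T → Polyhedron K}
    (hc : ∀ v, Continuous fun y => (h y).1 v)
    (hf : ∀ x, ∃ F : Finset V, ∀ᶠ y in 𝓝 x, ∀ v ∉ F, (h y).1 v = 0) : Continuous h := by
  classical
  rw [continuous_iff_continuousAt]
  intro x
  obtain ⟨F, hF⟩ := hf x
  -- The finitely many faces with vertices in `F` give closed sets on each of which `h` is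
  -- continuous. Their union is a neighbourhood of `x`, because a face containing the support of `h
  -- y` can be cut down to its intersection with `F`.
  let A : {s : Finset V // s ∈ F.powerset ∧ s ∈ K.faces} → Set T :=
    fun s => {y | h y ∈ simplex K s.1}
  have hfin : Finite {s : Finset V // s ∈ F.powerset ∧ s ∈ K.faces} :=
    Finite.of_injective (fun s => (⟨s.1, s.2.1⟩ : {s // s ∈ F.powerset}))
      fun a b hab => Subtype.ext (Subtype.mk.inj hab)
  have hcl : ∀ s, IsClosed (A s) := by
    intro s
    have hA : A s = ⋂ v : V, ⋂ _ : v ∉ s.1, {y | (h y).1 v = 0} := by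
      ext y
      simp [A, simplex]
    rw [hA]
    exact isClosed_iInter fun v => isClosed_iInter fun _ => isClosed_eq (hc v) continuous_const
  have hcont : ContinuousOn h (⋃ s, A s) := by
    refine (locallyFinite_of_finite A).continuousOn_iUnion hcl fun s => ?_
    rw [continuousOn_iff_continuous_domRestrict]
    exact continuous_of_mem_simplex s.2.2 (fun y => y.2) fun v => (hc v).comp continuous_subtype_val
  refine hcont.continuousAt ?_
  filter_upwards [hF] with y hy
  obtain ⟨s, hs, h0, h1⟩ := (h y).2.2
  have hmem : h y ∈ simplex K (s ∩ F) := by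
    intro v hv
    rw [Finset.mem_inter, not_and_or] at hv
    exact hv.elim (h0 v) (hy v)
  have hne : (s ∩ F).Nonempty := by
    rw [Finset.nonempty_iff_ne_empty]
    intro h0
    have := sum_eq_one_of_mem_simplex hmem
    simp [h0] at this
  exact Set.mem_iUnion.2 ⟨⟨s ∩ F, Finset.mem_powerset.2 Finset.inter_subset_right,
    (K.isRelLowerSet_faces hs).2 Finset.inter_subset_left hne⟩, hmem⟩

end Polyhedron

/-! ## Families of functions as maps into polyhedra -/

variable {V : Type u} {K : PreAbstractSimplicialComplex V} {T : Type v} [TopologicalSpace T]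

/-- A nonzero point of the cone `ℝ≥0 · |K|`, with coordinates at most `1`. -/
structure IsConePt (K : PreAbstractSimplicialComplex V) (a : V → ℝ) : Prop where
  nonneg : ∀ v, 0 ≤ a v
  le_one : ∀ v, a v ≤ 1
  face : ∃ s ∈ K.faces, ∀ v ∉ s, a v = 0
  pos : ∃ v, 0 < a v

/-- The largest coordinate. -/
noncomputable def peak (a : V → ℝ) : ℝ := ⨆ v, a v

namespace IsConePt

variable {a : V → ℝ} (h : IsConePt K a)

include h

theorem le_peak (v : V) : a v ≤ peak a :=
  le_ciSup ⟨1, by rintro _ ⟨v, rfl⟩; exact h.le_one v⟩ v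

theorem peak_pos : 0 < peak a :=
  let ⟨v, hv⟩ := h.pos
  hv.trans_le (h.le_peak v)

theorem peak_le {c : ℝ} (hc : ∀ v, a v ≤ c) : peak a ≤ c :=
  let ⟨v, _⟩ := h.pos
  have : Nonempty V := ⟨v⟩
  ciSup_le hc

theorem exists_eq_peak : ∃ v, a v = peak a := by
  obtain ⟨s, -, hs⟩ := h.face
  obtain ⟨v, hv⟩ := h.pos
  have hvs : v ∈ s := by
    by_contra h0
    exact hv.ne' (hs v h0)
  obtain ⟨w, -, hw⟩ := s.exists_max_image a ⟨v, hvs⟩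
  refine ⟨w, le_antisymm (h.le_peak w) (h.peak_le fun x => ?_)⟩
  by_cases hx : x ∈ s
  · exact hw x hx
  · rw [hs x hx]
    exact h.nonneg w

end IsConePt

/-- The excess of the coordinates over half of the largest one. -/
noncomputable def excess (a : V → ℝ) (v : V) : ℝ := max 0 (a v - peak a / 2)

namespace IsConePt

variable {a : V → ℝ} (h : IsConePt K a)

theorem excess_nonneg (a : V → ℝ) (v : V) : 0 ≤ excess a v := le_max_left _ _

theorem excess_eq_zero {a : V → ℝ} {v : V} (hv : a v ≤ peak a / 2) : excess a v = 0 :=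
  max_eq_left (by linarith)

include h

omit h in
theorem excess_pos_iff {v : V} : 0 < excess a v ↔ peak a / 2 < a v := by
  simp [excess]

omit h in
theorem finsum_excess {F : Finset V} (hF : ∀ v ∉ F, a v ≤ peak a / 2) :
    ∑ᶠ v, excess a v = ∑ v ∈ F, excess a v := by
  refine finsum_eq_sum_of_support_subset _ fun v hv => ?_
  by_contra h0
  exact hv (excess_eq_zero (hF v h0))

theorem exists_face_excess : ∃ s ∈ K.faces, (∀ v ∉ s, excess a v = 0) ∧
    ∑ᶠ v, excess a v = ∑ v ∈ s, excess a v := by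
  obtain ⟨s, hs, h0⟩ := h.face
  have h1 : ∀ v ∉ s, a v ≤ peak a / 2 := fun v hv => by
    rw [h0 v hv]
    linarith [h.peak_pos]
  exact ⟨s, hs, fun v hv => excess_eq_zero (h1 v hv), finsum_excess h1⟩

theorem finsum_excess_pos : 0 < ∑ᶠ v, excess a v := by
  obtain ⟨s, -, h0, h1⟩ := h.exists_face_excess
  rw [h1]
  obtain ⟨v, hv⟩ := h.exists_eq_peak
  have hpos : 0 < excess a v := excess_pos_iff.2 (by rw [hv]; linarith [h.peak_pos])
  have hvs : v ∈ s := by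
    by_contra hv'
    exact hpos.ne' (h0 v hv')
  exact Finset.sum_pos' (fun v _ => excess_nonneg a v) ⟨v, hvs, hpos⟩

/-- The point of the polyhedron spanned by the large coordinates of a point of the cone. -/
noncomputable def toPolyhedron : Polyhedron K :=
  ⟨fun v => excess a v / ∑ᶠ u, excess a u,
    fun v => div_nonneg (excess_nonneg a v) h.finsum_excess_pos.le, by
      obtain ⟨s, hs, h0, h1⟩ := h.exists_face_excess
      refine ⟨s, hs, fun v hv => by simp only [h0 v hv, zero_div], ?_⟩
      rw [← Finset.sum_div, ← h1, div_self h.finsum_excess_pos.ne']⟩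

theorem pos_of_toPolyhedron_pos {v : V} (hv : 0 < h.toPolyhedron.1 v) : 0 < a v := by
  have h1 : 0 < excess a v := by
    by_contra h0
    have h2 : excess a v = 0 := le_antisymm (not_lt.1 h0) (excess_nonneg a v)
    have h3 : h.toPolyhedron.1 v = excess a v / ∑ᶠ u, excess a u := rfl
    rw [h3, h2, zero_div] at hv
    exact hv.false
  linarith [excess_pos_iff.1 h1, h.peak_pos]

/-- The peak and the excess are homogeneous of degree one, so the factor cancels in the
normalization. -/
theorem toPolyhedron_smul {b : V → ℝ} (hb : IsConePt K b) {c : ℝ} (hc : 0 < c)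
    (hab : ∀ v, a v = c * b v) : h.toPolyhedron = hb.toPolyhedron := by
  have h1 : peak a = c * peak b := by
    simp only [peak, hab]
    rw [Real.mul_iSup_of_nonneg hc.le]
  have h2 : ∀ v, excess a v = c * excess b v := by
    intro v
    simp only [excess]
    rw [hab, h1, mul_max_of_nonneg _ _ hc.le]
    congr 1 <;> ring
  refine Subtype.ext (funext fun v => ?_)
  change excess a v / ∑ᶠ u, excess a u = excess b v / ∑ᶠ u, excess b u
  simp only [h2]
  rw [← mul_finsum, mul_div_mul_left _ _ hc.ne']

end IsConePt

theorem Polyhedron.isConePt (t : Polyhedron K) : IsConePt K t.1 where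
  nonneg := t.2.1
  le_one := t.le_one
  face := let ⟨s, hs, h0, _⟩ := t.2.2; ⟨s, hs, h0⟩
  pos := t.exists_pos

/-- A continuous family of points of the cone over `|K|` whose coordinates are locally uniformly
small outside finite sets of vertices. -/
structure IsConeMap (K : PreAbstractSimplicialComplex V) (φ : T → V → ℝ) : Prop where
  pt : ∀ x, IsConePt K (φ x)
  cont : ∀ v, Continuous fun x => φ x v
  small : ∀ x, ∀ ε > 0, ∃ F : Finset V, ∀ᶠ y in 𝓝 x, ∀ v ∉ F, φ y v ≤ ε

namespace IsConeMap

variable {φ : T → V → ℝ} (h : IsConeMap K φ)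

include h

theorem eventually_le_half_peak (x : T) :
    ∃ F : Finset V, F.Nonempty ∧ ∀ᶠ y in 𝓝 x, ∀ v ∉ F, φ y v ≤ peak (φ y) / 2 := by
  have hp := (h.pt x).peak_pos
  -- Near `x`, a vertex with the largest coordinate at `x` keeps more than half of it, so half of
  -- the nearby peak exceeds a quarter of the peak at `x`.
  obtain ⟨F, hF⟩ := h.small x (peak (φ x) / 4) (by linarith)
  obtain ⟨v, hv⟩ := (h.pt x).exists_eq_peak
  have hv' : ∀ᶠ y in 𝓝 x, peak (φ x) / 2 < φ y v :=
    ((h.cont v).tendsto x).eventually (lt_mem_nhds (by simp only [hv]; linarith))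
  have key : ∀ᶠ y in 𝓝 x, ∀ v ∉ F, φ y v ≤ peak (φ y) / 2 := by
    filter_upwards [hF, hv'] with y h1 h2 w hw
    have := (h.pt y).le_peak v
    linarith [h1 w hw]
  refine ⟨F, ?_, key⟩
  have : v ∈ F := by
    by_contra h0
    have := key.self_of_nhds v h0
    linarith
  exact ⟨v, this⟩

/-- Near each point the peak is attained in one fixed finite set of vertices, so it is locally a
finite maximum. -/
theorem continuous_peak : Continuous fun x => peak (φ x) := by
  rw [continuous_iff_continuousAt]
  intro x
  obtain ⟨F, hne, hF⟩ := h.eventually_le_half_peak x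
  have hc : ContinuousAt (fun y => F.sup' hne (fun v => φ y v)) x := by
    refine Continuous.continuousAt ?_
    exact Continuous.finset_sup'_apply hne fun v _ => h.cont v
  refine hc.congr ?_
  filter_upwards [hF] with y hy
  refine le_antisymm (Finset.sup'_le _ _ fun v _ => (h.pt y).le_peak v) ?_
  obtain ⟨v, hv⟩ := (h.pt y).exists_eq_peak
  rw [← hv]
  refine Finset.le_sup' (fun v => φ y v) ?_
  by_contra h0
  have := hy v h0
  linarith [(h.pt y).peak_pos]

/-- The map into the polyhedron defined by a family of points of the cone. -/
noncomputable def realize : C(T, Polyhedron K) where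
  toFun x := (h.pt x).toPolyhedron
  continuous_toFun := by
    have he : ∀ v, Continuous fun x => excess (φ x) v := fun v =>
      continuous_const.max ((h.cont v).sub (h.continuous_peak.div_const 2))
    have hs : Continuous fun x => ∑ᶠ u, excess (φ x) u := by
      rw [continuous_iff_continuousAt]
      intro x
      obtain ⟨F, -, hF⟩ := h.eventually_le_half_peak x
      refine (continuous_finsetSum F fun v _ => he v).continuousAt.congr ?_
      filter_upwards [hF] with y hy
      exact (IsConePt.finsum_excess hy).symm
    -- The cut-off at half the peak turns coordinates that are merely small outside `F` into ones
    -- that vanish there.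
    refine Polyhedron.continuous_of_locallyFinite
      (fun v => (he v).div hs fun x => (h.pt x).finsum_excess_pos.ne') fun x => ?_
    obtain ⟨F, -, hF⟩ := h.eventually_le_half_peak x
    refine ⟨F, ?_⟩
    filter_upwards [hF] with y hy v hv
    change excess (φ y) v / _ = 0
    rw [IsConePt.excess_eq_zero (hy v hv), zero_div]

theorem comp {S : Type w} [TopologicalSpace S] (f : C(S, T)) :
    IsConeMap K fun x => φ (f x) where
  pt x := h.pt (f x)
  cont v := (h.cont v).comp f.continuous
  small x ε hε :=
    let ⟨F, hF⟩ := h.small (f x) ε hε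
    ⟨F, (f.continuous.tendsto x).eventually hF⟩

end IsConeMap

/-- A finite set carrying the whole mass `1` at `x` carries more than `1 - ε` nearby, which leaves
less than `ε` for any other vertex. Only continuity of the single coordinates is needed, so the
topology on the source may be coarser than the weak one. -/
theorem IsConeMap.coord {h : T → Polyhedron K} (hc : ∀ v, Continuous fun y => (h y).1 v) :
    IsConeMap K fun x => (h x).1 where
  pt x := (h x).isConePt
  cont := hc
  small x ε hε := by
    classical
    obtain ⟨s, -, h0, h1⟩ := (h x).2.2
    have hs : Continuous fun y => ∑ v ∈ s, (h y).1 v := continuous_finsetSum s fun v _ => hc v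
    refine ⟨s, ?_⟩
    filter_upwards [(hs.tendsto x).eventually (lt_mem_nhds (show 1 - ε < _ by linarith))]
      with y hy v hv
    have := (h y).sum_le_one (insert v s)
    rw [Finset.sum_insert hv] at this
    linarith

theorem IsConeMap.of_continuousMap (f : C(T, Polyhedron K)) : IsConeMap K fun x => (f x).1 :=
  IsConeMap.coord fun v => (Polyhedron.continuous_coord v).comp f.continuous

/-- A homotopy of cone families. -/
theorem IsConeMap.homotopic {φ₀ φ₁ : T → V → ℝ} (h₀ : IsConeMap K φ₀) (h₁ : IsConeMap K φ₁)
    {Φ : unitInterval × T → V → ℝ} (hΦ : IsConeMap K Φ) (e₀ : ∀ x, Φ (0, x) = φ₀ x)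
    (e₁ : ∀ x, Φ (1, x) = φ₁ x) : h₀.realize.Homotopic h₁.realize :=
  ⟨{ toContinuousMap := hΦ.realize
     map_zero_left := fun x => by
      change (hΦ.pt (0, x)).toPolyhedron = (h₀.pt x).toPolyhedron
      congr 1
      exact e₀ x
     map_one_left := fun x => by
      change (hΦ.pt (1, x)).toPolyhedron = (h₁.pt x).toPolyhedron
      congr 1
      exact e₁ x }⟩

/-- Families which have a common vertex at every point are homotopic. -/
theorem IsConeMap.homotopic_of_common {φ₀ φ₁ : T → V → ℝ} (h₀ : IsConeMap K φ₀)
    (h₁ : IsConeMap K φ₁) (hc : ∀ x, ∃ v, 0 < φ₀ x v ∧ 0 < φ₁ x v) :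
    h₀.realize.Homotopic h₁.realize := by
  -- The homotopy runs from `φ₀` to `min φ₀ φ₁` and then to `φ₁`. An added constant `1` switches one
  -- argument of the minimum off at each end, because coordinates are at most `1`. Each half stays
  -- below `φ₀` or below `φ₁`, hence in a simplex, and the common vertex keeps it nonzero.
  let Φ : unitInterval × T → V → ℝ := fun p v =>
    min (φ₀ p.2 v + max 0 (2 * (p.1 : ℝ) - 1)) (φ₁ p.2 v + max 0 (1 - 2 * (p.1 : ℝ)))
  have hle : ∀ p : unitInterval × T, (∀ v, Φ p v ≤ φ₀ p.2 v) ∨ ∀ v, Φ p v ≤ φ₁ p.2 v := by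
    intro p
    rcases le_total (2 * (p.1 : ℝ)) 1 with h | h
    · exact Or.inl fun v => (min_le_left _ _).trans (by rw [max_eq_left (by linarith), add_zero])
    · exact Or.inr fun v => (min_le_right _ _).trans (by rw [max_eq_left (by linarith), add_zero])
  have hnn : ∀ p v, 0 ≤ Φ p v := fun p v =>
    le_min (add_nonneg ((h₀.pt p.2).nonneg v) (le_max_left _ _))
      (add_nonneg ((h₁.pt p.2).nonneg v) (le_max_left _ _))
  have hface : ∀ p (a : V → ℝ), IsConePt K a → (∀ v, Φ p v ≤ a v) → IsConePt K (Φ p) := by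
    intro p a ha hpa
    refine ⟨hnn p, fun v => (hpa v).trans (ha.le_one v), ?_, ?_⟩
    · obtain ⟨s, hs, h0⟩ := ha.face
      exact ⟨s, hs, fun v hv => le_antisymm (h0 v hv ▸ hpa v) (hnn p v)⟩
    · obtain ⟨v, hv₀, hv₁⟩ := hc p.2
      exact ⟨v, lt_min (add_pos_of_pos_of_nonneg hv₀ (le_max_left _ _))
        (add_pos_of_pos_of_nonneg hv₁ (le_max_left _ _))⟩
  have hΦ : IsConeMap K Φ := by
    refine ⟨fun p => (hle p).elim (hface p _ (h₀.pt p.2)) (hface p _ (h₁.pt p.2)), fun v => ?_,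
      fun p ε hε => ?_⟩
    · have c₀ := h₀.cont v
      have c₁ := h₁.cont v
      fun_prop
    · classical
      obtain ⟨F₀, hF₀⟩ := h₀.small p.2 ε hε
      obtain ⟨F₁, hF₁⟩ := h₁.small p.2 ε hε
      refine ⟨F₀ ∪ F₁, ?_⟩
      filter_upwards [(continuous_snd.tendsto p).eventually hF₀,
        (continuous_snd.tendsto p).eventually hF₁] with q hq₀ hq₁ v hv
      rw [Finset.mem_union, not_or] at hv
      exact (hle q).elim (fun h => (h v).trans (hq₀ v hv.1)) fun h => (h v).trans (hq₁ v hv.2)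
  refine IsConeMap.homotopic h₀ h₁ hΦ (fun x => funext fun v => ?_) fun x => funext fun v => ?_
  · have := (h₀.pt x).le_one v
    have := (h₁.pt x).nonneg v
    simp only [Φ, Set.Icc.coe_zero]
    norm_num
    linarith
  · have := (h₁.pt x).le_one v
    have := (h₀.pt x).nonneg v
    simp only [Φ, Set.Icc.coe_one]
    norm_num
    linarith

/-- Pushing a polyhedron towards the large coordinates is homotopic to the identity. -/
theorem Polyhedron.realize_id_homotopic :
    (IsConeMap.of_continuousMap (ContinuousMap.id (Polyhedron K))).realize.Homotopic
      (ContinuousMap.id (Polyhedron K)) := by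
  set r := (IsConeMap.of_continuousMap (ContinuousMap.id (Polyhedron K))).realize with hr
  -- The push creates no new vertices, so the straight-line homotopy to the identity stays in each
  -- closed simplex.
  have hmem : ∀ (t : Polyhedron K) (s : Finset V), t ∈ simplex K s → r t ∈ simplex K s := by
    intro t s ht v hv
    by_contra h0
    have h1 := IsConePt.pos_of_toPolyhedron_pos (h := t.isConePt)
      (lt_of_le_of_ne ((r t).2.1 v) (Ne.symm h0))
    exact h1.ne' (ht v hv)
  let G : unitInterval → Polyhedron K → Polyhedron K := fun τ t =>
    ⟨fun v => (1 - (τ : ℝ)) * (r t).1 v + τ * t.1 v, fun v =>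
      add_nonneg (mul_nonneg (by linarith [τ.2.2]) ((r t).2.1 v)) (mul_nonneg τ.2.1 (t.2.1 v)), by
      obtain ⟨s, hs, h0, h1⟩ := t.2.2
      have h0' := hmem t s h0
      refine ⟨s, hs, fun v hv => ?_, ?_⟩
      · change (1 - (τ : ℝ)) * (r t).1 v + τ * t.1 v = 0
        rw [h0' v hv, h0 v hv]
        ring
      rw [Finset.sum_add_distrib, ← Finset.mul_sum, ← Finset.mul_sum, h1,
        sum_eq_one_of_mem_simplex h0']
      ring⟩
  have hG : ∀ (s : Finset V) (hs : s ∈ K.faces),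
      Continuous fun p : StdFace s × unitInterval => G p.2 (ofFace hs p.1) := by
    intro s hs
    have hm : ∀ a : StdFace s, ofFace hs a ∈ simplex K s := fun a => a.2.2.1
    have hco : Continuous fun a : StdFace s => ofFace hs a :=
      continuous_of_mem_simplex hs hm fun v => (continuous_apply v).comp continuous_subtype_val
    refine continuous_of_mem_simplex hs (fun p v hv => ?_) fun v => ?_
    · change (1 - (p.2 : ℝ)) * (r (ofFace hs p.1)).1 v + p.2 * (ofFace hs p.1).1 v = 0
      rw [hmem _ s (hm p.1) v hv, hm p.1 v hv]
      ring
    · change Continuous fun p : StdFace s × unitInterval =>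
        (1 - (p.2 : ℝ)) * (r (ofFace hs p.1)).1 v + p.2 * (ofFace hs p.1).1 v
      have c1 : Continuous fun a : StdFace s => (r (ofFace hs a)).1 v :=
        (continuous_coord v).comp (r.continuous.comp hco)
      have c2 : Continuous fun a : StdFace s => (ofFace hs a).1 v := (continuous_coord v).comp hco
      exact ((continuous_const.sub (continuous_subtype_val.comp continuous_snd)).mul
        (c1.comp continuous_fst)).add
        ((continuous_subtype_val.comp continuous_snd).mul (c2.comp continuous_fst))
  -- Joint continuity on the product with the interval cannot be read off simplex by simplex
  -- directly. The curried map into the space of paths can be tested on simplices, and uncurrying is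
  -- allowed because the interval is locally compact.
  let Γ : Polyhedron K → C(unitInterval, Polyhedron K) := fun t => ⟨fun τ => G τ t, by
    obtain ⟨s, hs, h0⟩ := t.2.2
    exact (hG s hs).comp (Continuous.prodMk continuous_const continuous_id :
      Continuous fun τ => ((⟨t.1, t.2.1, h0⟩ : StdFace s), τ))⟩
  have hΓ : Continuous Γ := continuous_dom fun s hs =>
    (ContinuousMap.curry ⟨_, hG s hs⟩ : C(StdFace s, C(unitInterval, Polyhedron K))).continuous
  have hcont : Continuous fun p : unitInterval × Polyhedron K => G p.1 p.2 :=
    (ContinuousMap.continuous_uncurry_of_continuous ⟨Γ, hΓ⟩).comp continuous_swap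
  exact ⟨{ toFun := fun p => G p.1 p.2
           continuous_toFun := hcont
           map_zero_left := fun t => Subtype.ext (funext fun v => by simp [G])
           map_one_left := fun t => Subtype.ext (funext fun v => by simp [G]) }⟩

/-- The realization of `f` is by definition `f` followed by the push of `K` towards the large
coordinates. -/
theorem IsConeMap.realize_homotopic (f : C(T, Polyhedron K)) :
    (IsConeMap.of_continuousMap f).realize.Homotopic f :=
  Polyhedron.realize_id_homotopic.comp (ContinuousMap.Homotopic.refl f)

/-! ## Blending families of points of a polyhedron -/

section Blend

variable {ι : Type w} {V : Type u} {N : PreAbstractSimplicialComplex ι}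
  {K : PreAbstractSimplicialComplex V} {y : ι → ℝ} {a : ι → V → ℝ}

/-- A combination of the points `a i` with weights `y i` whose support lies in that of `a i` for
each `i` of maximal weight. -/
noncomputable def blend (y : ι → ℝ) (a : ι → V → ℝ) (v : V) : ℝ :=
  ⨅ i, (peak y * a i v + 2 * (peak y - y i))

namespace IsConePt

variable (hy : IsConePt N y)

include hy

theorem blend_term_nonneg {v : V} (ha : ∀ i, 0 ≤ a i v) (i : ι) :
    0 ≤ peak y * a i v + 2 * (peak y - y i) := by
  have := mul_nonneg hy.peak_pos.le (ha i)
  linarith [hy.le_peak i]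

theorem blend_le {v : V} (ha : ∀ i, 0 ≤ a i v) (i : ι) :
    blend y a v ≤ peak y * a i v + 2 * (peak y - y i) :=
  ciInf_le ⟨0, by rintro _ ⟨j, rfl⟩; exact hy.blend_term_nonneg ha j⟩ i

theorem blend_nonneg {v : V} (ha : ∀ i, 0 ≤ a i v) : 0 ≤ blend y a v :=
  Real.iInf_nonneg fun i => hy.blend_term_nonneg ha i

theorem blend_le_of_eq_peak {v : V} (ha : ∀ i, 0 ≤ a i v) {i : ι} (hi : y i = peak y) :
    blend y a v ≤ peak y * a i v := by
  have := hy.blend_le ha i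
  linarith

/-- An index of weight `0` contributes at least `2 * peak y`, which cannot undercut `peak y * c`. -/
theorem le_blend {v : V} (ha : ∀ i, 0 ≤ a i v) {c : ℝ} (hc : c ≤ 1)
    (h : ∀ i, 0 < y i → c ≤ a i v) : peak y * c ≤ blend y a v := by
  obtain ⟨i, -⟩ := hy.pos
  have : Nonempty ι := ⟨i⟩
  refine le_ciInf fun i => ?_
  have hp := hy.peak_pos
  rcases (hy.nonneg i).lt_or_eq with hi | hi
  · have := mul_le_mul_of_nonneg_left (h i hi) hp.le
    linarith [hy.le_peak i]
  · have h1 := mul_le_mul_of_nonneg_left hc hp.le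
    have h2 := mul_nonneg hp.le (ha i)
    rw [← hi]
    linarith

/-- The factor `2` in `blend` is chosen for this: an index of weight at most `peak y / 2`
contributes at least `peak y`, and an index of maximal weight contributes no more than that. -/
theorem blend_eq_inf' {v : V} (ha : ∀ i, 0 ≤ a i v) (ha1 : ∀ i, a i v ≤ 1) {F : Finset ι}
    (hF : ∀ i ∉ F, y i ≤ peak y / 2) (hne : F.Nonempty) :
    blend y a v = F.inf' hne fun i => peak y * a i v + 2 * (peak y - y i) := by
  have hp := hy.peak_pos
  obtain ⟨j, hj⟩ := hy.exists_eq_peak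
  have hjF : j ∈ F := by
    by_contra h0
    linarith [hF j h0]
  have : Nonempty ι := ⟨j⟩
  refine le_antisymm (Finset.le_inf' _ _ fun i _ => hy.blend_le ha i) (le_ciInf fun i => ?_)
  by_cases hi : i ∈ F
  · exact Finset.inf'_le _ hi
  · refine (Finset.inf'_le _ hjF).trans ?_
    have h1 := mul_le_mul_of_nonneg_left (ha1 j) hp.le
    have h2 := mul_nonneg hp.le (ha i)
    linarith [hF i hi]

theorem blend_pos {v : V} (ha : ∀ i, 0 ≤ a i v) (ha1 : ∀ i, a i v ≤ 1)
    (h : ∀ i, 0 < y i → 0 < a i v) : 0 < blend y a v := by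
  have hp := hy.peak_pos
  obtain ⟨s, -, hs⟩ := hy.face
  obtain ⟨j, hj⟩ := hy.pos
  have hjs : j ∈ s := by
    by_contra h0
    exact hj.ne' (hs j h0)
  rw [hy.blend_eq_inf' ha ha1 (F := s) (fun i hi => by rw [hs i hi]; linarith) ⟨j, hjs⟩]
  refine (Finset.lt_inf'_iff _).2 fun i _ => ?_
  rcases (hy.nonneg i).lt_or_eq with hi | hi
  · have := mul_pos hp (h i hi)
    linarith [hy.le_peak i]
  · have := mul_nonneg hp.le (ha i)
    rw [← hi]
    linarith

/-- The blend is dominated by any `a j` of maximal weight, so its support lies in a face of `K`. A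
convex combination of the `a i` would not have this property. -/
theorem blend_isConePt (ha : ∀ i, IsConePt K (a i)) (h : ∃ v, ∀ i, 0 < y i → 0 < a i v) :
    IsConePt K (blend y a) := by
  obtain ⟨j, hj⟩ := hy.exists_eq_peak
  have hp := hy.peak_pos
  have hnn : ∀ v, 0 ≤ blend y a v := fun v => hy.blend_nonneg fun i => (ha i).nonneg v
  have hle : ∀ v, blend y a v ≤ peak y * a j v := fun v =>
    hy.blend_le_of_eq_peak (fun i => (ha i).nonneg v) hj
  refine ⟨hnn, fun v => (hle v).trans ?_, ?_, ?_⟩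
  · exact mul_le_one₀ (hy.peak_le hy.le_one) ((ha j).nonneg v) ((ha j).le_one v)
  · obtain ⟨s, hs, h0⟩ := (ha j).face
    refine ⟨s, hs, fun v hv => le_antisymm ((hle v).trans ?_) (hnn v)⟩
    rw [h0 v hv, mul_zero]
  · obtain ⟨v, hv⟩ := h
    exact ⟨v, hy.blend_pos (fun i => (ha i).nonneg v) (fun i => (ha i).le_one v) hv⟩

end IsConePt

/-- Locally the infimum runs over a fixed finite set of indices, which gives continuity. Smallness
is inherited from the finitely many families that can have maximal weight. -/
theorem IsConeMap.blend {T : Type v} [TopologicalSpace T] {y : T → ι → ℝ} (hy : IsConeMap N y)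
    {a : ι → T → V → ℝ} (ha : ∀ i, IsConeMap K (a i))
    (h : ∀ x, ∃ v, ∀ i, 0 < y x i → 0 < a i x v) :
    IsConeMap K fun x => blend (y x) fun i => a i x := by
  refine ⟨fun x => (hy.pt x).blend_isConePt (fun i => (ha i).pt x) (h x), fun v => ?_,
    fun x ε hε => ?_⟩
  · rw [continuous_iff_continuousAt]
    intro x
    obtain ⟨F, hne, hF⟩ := hy.eventually_le_half_peak x
    have hc : Continuous fun x => F.inf' hne fun i =>
        peak (y x) * a i x v + 2 * (peak (y x) - y x i) :=
      Continuous.finset_inf'_apply hne fun i _ =>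
        (hy.continuous_peak.mul ((ha i).cont v)).add
          (continuous_const.mul (hy.continuous_peak.sub (hy.cont i)))
    refine hc.continuousAt.congr ?_
    filter_upwards [hF] with z hz
    exact ((hy.pt z).blend_eq_inf' (fun i => ((ha i).pt z).nonneg v)
      (fun i => ((ha i).pt z).le_one v) hz hne).symm
  · classical
    obtain ⟨F, -, hF⟩ := hy.eventually_le_half_peak x
    choose S hS using fun i => (ha i).small x ε hε
    refine ⟨F.biUnion S, ?_⟩
    filter_upwards [hF, (Finset.eventually_all F).2 fun i _ => hS i] with z hz hz' v hv
    have hp := (hy.pt z).peak_pos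
    obtain ⟨j, hj⟩ := (hy.pt z).exists_eq_peak
    have hjF : j ∈ F := by
      by_contra h0
      linarith [hz j h0]
    have h1 := hz' j hjF v fun h0 => hv (Finset.mem_biUnion.2 ⟨j, hjF, h0⟩)
    have h2 := (hy.pt z).blend_le_of_eq_peak (v := v) (a := fun i => a i z)
      (fun i => ((ha i).pt z).nonneg v) hj
    have h3 := mul_le_of_le_one_left (((ha j).pt z).nonneg v) ((hy.pt z).peak_le (hy.pt z).le_one)
    exact h2.trans (h3.trans h1)

end Blend

/-! ## Neighbourhoods of points of a polyhedron -/

namespace Polyhedron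

variable {V : Type u} {K : PreAbstractSimplicialComplex V}

theorem abs_le_one (t : Polyhedron K) (v : V) : |t.1 v| ≤ 1 :=
  abs_le.2 ⟨by linarith [t.2.1 v], t.le_one v⟩

theorem exists_pos_le (z : Polyhedron K) : ∃ δ > 0, ∀ v, 0 < z.1 v → δ ≤ z.1 v := by
  classical
  obtain ⟨s, -, hs, -⟩ := z.2.2
  obtain ⟨v, hv⟩ := z.exists_pos
  have hmem : ∀ v, 0 < z.1 v → v ∈ s.filter fun v => 0 < z.1 v := by
    intro v hv
    refine Finset.mem_filter.2 ⟨?_, hv⟩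
    by_contra h0
    exact hv.ne' (hs v h0)
  obtain ⟨w, hw, hmin⟩ := (s.filter fun v => 0 < z.1 v).exists_min_image z.1 ⟨v, hmem v hv⟩
  exact ⟨z.1 w, (Finset.mem_filter.1 hw).2, fun v hv => hmin v (hmem v hv)⟩

/-- Only the finitely many positive coordinates of `z` impose a condition, and `(1 - κ)` times the
least of them serves as radius. -/
theorem exists_radius (z : Polyhedron K) {κ : ℝ} (hκ : κ < 1) :
    ∃ ρ > 0, ∀ u : Polyhedron K, (∀ v, |u.1 v - z.1 v| < ρ) → ∀ v, κ * z.1 v ≤ u.1 v := by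
  obtain ⟨δ, hδ, h⟩ := z.exists_pos_le
  refine ⟨(1 - κ) * δ, mul_pos (by linarith) hδ, fun u hu v => ?_⟩
  rcases (z.2.1 v).lt_or_eq with hv | hv
  · have h1 := (abs_lt.1 (hu v)).1
    have h2 := mul_le_mul_of_nonneg_left (h v hv) (show 0 ≤ 1 - κ by linarith)
    linarith
  · rw [← hv, mul_zero]
    exact u.2.1 v

/-- The other coordinates of `u` use up at least `κ * (1 - z v)` of the total mass `1`. -/
theorem le_of_scaled_le {z u : Polyhedron K} {κ : ℝ} (h : ∀ v, κ * z.1 v ≤ u.1 v) (v : V) :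
    u.1 v ≤ κ * z.1 v + (1 - κ) := by
  classical
  obtain ⟨s, -, hs, -⟩ := z.2.2
  have h1 : ∑ x ∈ insert v s, z.1 x = 1 :=
    sum_eq_one_of_mem_simplex fun x hx => hs x fun h0 => hx (Finset.mem_insert_of_mem h0)
  have h2 := u.sum_le_one (insert v s)
  rw [← Finset.add_sum_erase _ _ (Finset.mem_insert_self v s)] at h1 h2
  have h3 : ∑ x ∈ (insert v s).erase v, κ * z.1 x ≤ ∑ x ∈ (insert v s).erase v, u.1 x :=
    Finset.sum_le_sum fun x _ => h x
  rw [← Finset.mul_sum] at h3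
  have h4 : ∑ x ∈ (insert v s).erase v, z.1 x = 1 - z.1 v := by linarith
  rw [h4] at h3
  linarith

/-- Points whose coordinates are at least those of `κ • z`, with `κ` close to `1`, are close to
`z` even in the topology of pointwise convergence of coordinates. -/
theorem exists_scale {W : Type w} {L : PreAbstractSimplicialComplex W}
    (g : C(Polyhedron K, Polyhedron L)) (z : Polyhedron K) {w : W}
    (hw : 0 < (g z.isConePt.toPolyhedron).1 w) :
    ∃ κ : ℝ, 0 ≤ κ ∧ κ < 1 ∧ ∀ u : Polyhedron K, (∀ v, κ * z.1 v ≤ u.1 v) →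
      0 < (g u.isConePt.toPolyhedron).1 w := by
  by_contra! hcon
  -- `S` has the same points as the polyhedron, but the topology of pointwise convergence. The push
  -- towards large coordinates is continuous from `S` to the weak topology, so a sequence of
  -- counterexamples with `κ` tending to `1` converges in `S` and yields a contradiction.
  let S : Type u :=
    {t : V → ℝ // (∀ x, 0 ≤ t x) ∧ ∃ s ∈ K.faces, (∀ x, x ∉ s → t x = 0) ∧ ∑ x ∈ s, t x = 1}
  let c : S → Polyhedron K := fun t => t
  have hc : IsConeMap K fun t => (c t).1 :=
    IsConeMap.coord fun v => (continuous_apply v).comp continuous_subtype_val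
  have hcont : Continuous fun t : S => (g (hc.realize t)).1 w :=
    (continuous_coord w).comp (g.continuous.comp hc.realize.continuous)
  let κ : ℕ → ℝ := fun n => 1 - 1 / ((n : ℝ) + 1)
  have hκ0 : ∀ n, 0 ≤ κ n := fun n => by
    have : 1 / ((n : ℝ) + 1) ≤ 1 := by
      rw [div_le_one (by positivity)]
      linarith [(Nat.cast_nonneg n : (0 : ℝ) ≤ n)]
    simp only [κ]
    linarith
  have hκ1 : ∀ n, κ n < 1 := fun n => by
    have : 0 < 1 / ((n : ℝ) + 1) := by positivity
    simp only [κ]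
    linarith
  choose t ht htw using fun n => hcon (κ n) (hκ0 n) (hκ1 n)
  have hκ : Tendsto κ atTop (𝓝 1) := by
    simpa [κ] using (tendsto_const_nhds (x := (1 : ℝ))).sub
      (tendsto_one_div_add_atTop_nhds_zero_nat (𝕜 := ℝ))
  let t' : ℕ → S := t
  let z' : S := z
  have hlim : Tendsto t' atTop (𝓝 z') := by
    refine tendsto_subtype_rng.2 (tendsto_pi_nhds.2 fun v => ?_)
    refine tendsto_of_tendsto_of_tendsto_of_le_of_le (g := fun n => κ n * z.1 v)
      (h := fun n => κ n * z.1 v + (1 - κ n)) ?_ ?_ (fun n => ht n v)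
      fun n => le_of_scaled_le (ht n) v
    · simpa using hκ.mul_const (z.1 v)
    · simpa using (hκ.mul_const (z.1 v)).add ((tendsto_const_nhds (x := (1 : ℝ))).sub hκ)
  obtain ⟨n, hn⟩ := (((hcont.tendsto z').comp hlim).eventually (lt_mem_nhds hw)).exists
  exact absurd hn (not_lt.2 (htw n))

end Polyhedron

theorem IsConePt.exists_polyhedron {V : Type u} {K : PreAbstractSimplicialComplex V} {a : V → ℝ}
    (h : IsConePt K a) : ∃ (u : Polyhedron K) (c : ℝ), 0 < c ∧ ∀ v, a v = c * u.1 v := by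
  obtain ⟨s, hs, h0⟩ := h.face
  obtain ⟨v, hv⟩ := h.pos
  have hvs : v ∈ s := by
    by_contra h1
    exact hv.ne' (h0 v h1)
  have hpos : 0 < ∑ x ∈ s, a x := Finset.sum_pos' (fun x _ => h.nonneg x) ⟨v, hvs, hv⟩
  refine ⟨⟨fun v => a v / ∑ x ∈ s, a x, fun x => div_nonneg (h.nonneg x) hpos.le, s, hs,
    fun x hx => by simp only [h0 x hx, zero_div], ?_⟩, _, hpos, fun v => ?_⟩
  · rw [← Finset.sum_div, div_self hpos.ne']
  · exact (mul_div_cancel₀ _ hpos.ne').symm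

/-! ## Nerves -/

/-- The complex of all finite sets of points contained in some `B i`. -/
def nerve {X : Type u} (B : X → Set X) : PreAbstractSimplicialComplex X where
  faces := {s | s.Nonempty ∧ ∃ i, ∀ j ∈ s, j ∈ B i}
  isRelLowerSet_faces := fun _ hs =>
    ⟨hs.1, fun _ ht hne => ⟨hne, hs.2.imp fun _ hi j hj => hi j (ht hj)⟩⟩

theorem nerve.exists_forall_mem {X : Type u} {B : X → Set X} (y : Polyhedron (nerve B)) :
    ∃ i, ∀ j, 0 < y.1 j → j ∈ B i := by
  obtain ⟨s, ⟨-, i, hi⟩, h0, -⟩ := y.2.2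
  refine ⟨i, fun j hj => hi j ?_⟩
  by_contra h1
  exact hj.ne' (h0 j h1)

/-- A family of functions which is locally uniformly continuous in the parameter is controlled by
a continuous map into a metric space. -/
theorem exists_continuous_metric {X : Type u} [TopologicalSpace X] {α : Type v} (A : X → α → ℝ)
    (hA1 : ∀ x a, |A x a| ≤ 1) (hA : ∀ x, ∀ ε > 0, ∀ᶠ y in 𝓝 x, ∀ a, |A y a - A x a| ≤ ε) :
    ∃ (E : Type v) (_ : MetricSpace E) (Ψ : X → E), Continuous Ψ ∧
      ∀ x y a, |A x a - A y a| ≤ dist (Ψ x) (Ψ y) := by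
  let _ : TopologicalSpace α := ⊥
  have _ : DiscreteTopology α := ⟨rfl⟩
  let Ψ : X → BoundedContinuousFunction α ℝ := fun x =>
    BoundedContinuousFunction.ofNormedAddCommGroup (A x) continuous_of_discreteTopology 1 (hA1 x)
  refine ⟨BoundedContinuousFunction α ℝ, inferInstance, Ψ, ?_, fun x y a =>
    BoundedContinuousFunction.dist_coe_le_dist (f := Ψ x) (g := Ψ y) a⟩
  rw [continuous_iff_continuousAt]
  intro x
  rw [ContinuousAt, Metric.tendsto_nhds]
  intro ε hε
  filter_upwards [hA x (ε / 2) (by linarith)] with y hy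
  refine lt_of_le_of_lt ((BoundedContinuousFunction.dist_le (by linarith)).2 fun a => ?_)
    (half_lt_self hε)
  exact hy a

/-- The canonical map into the nerve of a cover by balls of a continuous pseudometric. -/
theorem exists_coneMap_nerve {X : Type u} [TopologicalSpace X] {α : Type v} (A : X → α → ℝ)
    (hA1 : ∀ x a, |A x a| ≤ 1)
    (hA : ∀ x, ∀ ε > 0, ∀ᶠ y in 𝓝 x, ∀ a, |A y a - A x a| ≤ ε) (ρ : X → ℝ) (hρ : ∀ x, 0 < ρ x)
    {B : X → Set X} (hB : ∀ i x, (∀ a, |A x a - A i a| < ρ i) → x ∈ B i) :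
    ∃ φ : X → X → ℝ, IsConeMap (nerve B) φ ∧ ∀ x, ∃ i, x ∈ B i ∧ ∀ j, 0 < φ x j → j ∈ B i := by
  obtain ⟨E, _, Ψ, hΨ, hAΨ⟩ := exists_continuous_metric A hA1 hA
  -- The range is a metric space, so it has the partitions of unity that `X` may lack.
  let Ψ' : X → Set.range Ψ := fun x => ⟨Ψ x, x, rfl⟩
  have hΨ' : Continuous Ψ' := hΨ.subtype_mk _
  obtain ⟨p, hp⟩ := PartitionOfUnity.exists_isSubordinate (isClosed_univ (X := Set.range Ψ))
    (fun i : X => Metric.ball (Ψ' i) (ρ i / 2)) (fun i => Metric.isOpen_ball) (by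
      rintro ⟨_, x, rfl⟩ -
      exact Set.mem_iUnion.2 ⟨x, Metric.mem_ball_self (half_pos (hρ x))⟩)
  have hdist : ∀ x i, 0 < p i (Ψ' x) → dist (Ψ x) (Ψ i) < ρ i / 2 := fun x i hi =>
    hp i (subset_tsupport _ hi.ne')
  have hmem : ∀ x i, dist (Ψ x) (Ψ i) < ρ i → x ∈ B i := fun x i h =>
    hB i x fun a => (hAΨ x i a).trans_lt h
  have hfin : ∀ x, {i | 0 < p i (Ψ' x)}.Finite := fun x =>
    (p.locallyFinite.point_finite (Ψ' x)).subset fun i hi => (show 0 < p i (Ψ' x) from hi).ne'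
  have key : ∀ x, ∃ i, x ∈ B i ∧ ∀ j, 0 < p j (Ψ' x) → j ∈ B i := by
    intro x
    obtain ⟨i₀, hi₀⟩ := p.exists_pos (Set.mem_univ (Ψ' x))
    -- Among the indices active at `x`, one with the largest radius is taken. Any other active
    -- centre is at distance less than `ρ j / 2 + ρ i / 2 ≤ ρ i` from its centre, so all active
    -- indices lie in one `B i` and span a simplex.
    obtain ⟨i, hi, hmax⟩ := Set.exists_max_image _ ρ (hfin x) ⟨i₀, hi₀⟩
    have h1 := hdist x i hi
    refine ⟨i, hmem x i (by linarith [hρ i]), fun j hj => hmem j i ?_⟩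
    have h2 := hdist x j hj
    have h3 := dist_triangle_left (Ψ j) (Ψ i) (Ψ x)
    have h4 := hmax j hj
    linarith
  refine ⟨fun x i => p i (Ψ' x), ⟨fun x => ⟨fun i => p.nonneg i _, fun i => p.le_one i _, ?_,
    p.exists_pos (Set.mem_univ _)⟩, fun i => (p i).continuous.comp hΨ', fun x ε hε => ?_⟩, key⟩
  · obtain ⟨i₀, hi₀⟩ := p.exists_pos (Set.mem_univ (Ψ' x))
    obtain ⟨i, -, hi⟩ := key x
    refine ⟨(hfin x).toFinset, ⟨⟨i₀, (hfin x).mem_toFinset.2 hi₀⟩, i, fun j hj =>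
      hi j ((hfin x).mem_toFinset.1 hj)⟩, fun j hj => ?_⟩
    rw [Set.Finite.mem_toFinset] at hj
    exact le_antisymm (not_lt.1 hj) (p.nonneg j _)
  · obtain ⟨t, ht, hf⟩ := p.locallyFinite (Ψ' x)
    refine ⟨hf.toFinset, ?_⟩
    filter_upwards [hΨ'.continuousAt.preimage_mem_nhds ht] with y hy i hi
    have : p i (Ψ' y) = 0 := by
      by_contra h0
      exact hi (hf.mem_toFinset.2 ⟨Ψ' y, h0, hy⟩)
    rw [this]
    exact hε.le

theorem IsConeMap.eventually_abs_sub_le {V : Type u} {K : PreAbstractSimplicialComplex V}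
    {T : Type v} [TopologicalSpace T] {φ : T → V → ℝ} (h : IsConeMap K φ) (x : T) {ε : ℝ}
    (hε : 0 < ε) : ∀ᶠ y in 𝓝 x, ∀ v, |φ y v - φ x v| ≤ ε := by
  obtain ⟨F, hF⟩ := h.small x ε hε
  have h1 : ∀ᶠ y in 𝓝 x, ∀ v ∈ F, |φ y v - φ x v| < ε := (Finset.eventually_all F).2 fun v _ =>
    ((h.cont v).tendsto x).eventually (Metric.ball_mem_nhds _ hε)
  have hx := hF.self_of_nhds
  filter_upwards [hF, h1] with y hy hy' v
  by_cases hv : v ∈ F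
  · exact (hy' v hv).le
  · have := (h.pt x).nonneg v
    have := (h.pt y).nonneg v
    rw [abs_le]
    constructor <;> linarith [hy v hv, hx v hv]

/-- Compactness of `S` makes the local estimate uniform in the parameter. Both points are compared
with the same `(s, x)`, whence `ε / 2`. -/
theorem IsConeMap.eventually_forall_abs_sub_le {V : Type u} {K : PreAbstractSimplicialComplex V}
    {S : Type w} [TopologicalSpace S] [CompactSpace S] {T : Type v} [TopologicalSpace T]
    {φ : S × T → V → ℝ} (h : IsConeMap K φ) (x : T) {ε : ℝ} (hε : 0 < ε) :
    ∀ᶠ y in 𝓝 x, ∀ s v, |φ (s, y) v - φ (s, x) v| ≤ ε := by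
  have key : ∀ᶠ y in 𝓝 x, ∀ s ∈ (Set.univ : Set S), ∀ v, |φ (s, y) v - φ (s, x) v| ≤ ε := by
    refine isCompact_univ.eventually_forall_of_forall_eventually fun s _ => ?_
    have h1 := h.eventually_abs_sub_le (s, x) (half_pos hε)
    have c1 : Tendsto (fun z : T × S => (z.2, z.1)) (𝓝 (x, s)) (𝓝 (s, x)) :=
      continuous_swap.tendsto (x, s)
    have c2 : Tendsto (fun z : T × S => (z.2, x)) (𝓝 (x, s)) (𝓝 (s, x)) :=
      (Continuous.prodMk continuous_snd continuous_const :
        Continuous fun z : T × S => (z.2, x)).tendsto (x, s)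
    filter_upwards [c1.eventually h1, c2.eventually h1] with z h2 h3 v
    have h4 := abs_le.1 (h2 v)
    have h5 := abs_le.1 (h3 v)
    rw [abs_le]
    constructor <;> linarith
  filter_upwards [key] with y hy s
  exact hy s trivial

/-- All indices active at `y` lie in one `B i`. Hence both the normalized blend of the points `f j`
and each active `f j` itself dominate `κ i • f i`, and `hg` gives one vertex `w` that is positive
for all of their images under the push and `g`. -/
theorem blend_common {X : Type w} {V : Type u} {W : Type v} {K : PreAbstractSimplicialComplex V}
    {L : PreAbstractSimplicialComplex W} {B : X → Set X} {f : X → Polyhedron K} {κ : X → ℝ}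
    (hκ : ∀ i, κ i < 1) (hB : ∀ i, ∀ x ∈ B i, ∀ v, κ i * (f i).1 v ≤ (f x).1 v)
    (g : C(Polyhedron K, Polyhedron L))
    (hg : ∀ i, ∃ w, ∀ u : Polyhedron K, (∀ v, κ i * (f i).1 v ≤ u.1 v) →
      0 < (g u.isConePt.toPolyhedron).1 w)
    (y : Polyhedron (nerve B)) (h : IsConePt K (blend y.1 fun i => (f i).1)) :
    ∃ w, 0 < (g h.toPolyhedron).1 w ∧
      0 < blend y.1 (fun i => (g (f i).isConePt.toPolyhedron).1) w := by
  obtain ⟨i, hi⟩ := nerve.exists_forall_mem y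
  obtain ⟨w, hw⟩ := hg i
  have hy := y.isConePt
  have hp := hy.peak_pos
  refine ⟨w, ?_, hy.blend_pos (fun j => (g _).2.1 w) (fun j => (g _).le_one w)
    fun j hj => hw _ (hB i j (hi j hj))⟩
  obtain ⟨u, c, hc, hu⟩ := h.exists_polyhedron
  rw [h.toPolyhedron_smul u.isConePt hc hu]
  refine hw u fun v => ?_
  -- Compare coordinate sums: the blend is at most `peak y` times a point of total mass `1`.
  have hc1 : c ≤ peak y.1 := by
    obtain ⟨j, hj⟩ := hy.exists_eq_peak
    obtain ⟨s, -, -, hs⟩ := u.2.2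
    calc c = ∑ x ∈ s, c * u.1 x := by rw [← Finset.mul_sum, hs, mul_one]
      _ ≤ ∑ x ∈ s, peak y.1 * (f j).1 x := Finset.sum_le_sum fun x _ => by
        rw [← hu]
        exact hy.blend_le_of_eq_peak (fun k => (f k).2.1 x) hj
      _ ≤ peak y.1 := by
        rw [← Finset.mul_sum]
        exact mul_le_of_le_one_right hp.le ((f j).sum_le_one s)
  have h1 : peak y.1 * (κ i * (f i).1 v) ≤ blend y.1 (fun i => (f i).1) v := by
    refine hy.le_blend (fun k => (f k).2.1 v) ?_ fun j hj => hB i j (hi j hj) v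
    have := mul_le_mul_of_nonneg_right (hκ i).le ((f i).2.1 v)
    linarith [(f i).le_one v]
  rw [hu] at h1
  have h2 := mul_le_mul_of_nonneg_right hc1 (u.2.1 v)
  exact le_of_mul_le_mul_left (h1.trans h2) hp

/-- Given maps `f, f'` from `X` into polyhedra and maps `g, g'` which agree on `f` up to homotopy,
`f` and `f'` factor up to homotopy through a polyhedron with vertices in `X` on which `g` and `g'`
already agree. -/
theorem exists_nerve {X V V' W : Type u} [TopologicalSpace X] {K : PreAbstractSimplicialComplex V}
    {K' : PreAbstractSimplicialComplex V'} {L : PreAbstractSimplicialComplex W}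
    (f : C(X, Polyhedron K)) (f' : C(X, Polyhedron K')) (g g' : C(Polyhedron K, Polyhedron L))
    (hgg : (g.comp f).Homotopic (g'.comp f)) :
    ∃ (N : PreAbstractSimplicialComplex X) (h : C(X, Polyhedron N))
      (k : C(Polyhedron N, Polyhedron K)) (k' : C(Polyhedron N, Polyhedron K')),
      (k.comp h).Homotopic f ∧ (k'.comp h).Homotopic f' ∧ (g.comp k).Homotopic (g'.comp k) := by
  have hf := IsConeMap.of_continuousMap f
  have hf' := IsConeMap.of_continuousMap f'
  have hrf := IsConeMap.realize_homotopic f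
  -- The homotopy starts from the pushed map instead of `f`, because the estimate of
  -- `Polyhedron.exists_scale` concerns `g` after the push.
  obtain ⟨H⟩ : (g.comp hf.realize).Homotopic (g'.comp hf.realize) :=
    (((ContinuousMap.Homotopic.refl g).comp hrf).trans hgg).trans
      ((ContinuousMap.Homotopic.refl g').comp hrf.symm)
  have hH := IsConeMap.of_continuousMap H.toContinuousMap
  have hscale : ∀ i, ∃ κ : ℝ, 0 < κ ∧ κ < 1 ∧
      (∃ w, ∀ u : Polyhedron K, (∀ v, κ * (f i).1 v ≤ u.1 v) →
        0 < (g u.isConePt.toPolyhedron).1 w) ∧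
      (∃ w, ∀ u : Polyhedron K, (∀ v, κ * (f i).1 v ≤ u.1 v) →
        0 < (g' u.isConePt.toPolyhedron).1 w) := by
    intro i
    obtain ⟨w, hw⟩ := (g (f i).isConePt.toPolyhedron).exists_pos
    obtain ⟨w', hw'⟩ := (g' (f i).isConePt.toPolyhedron).exists_pos
    obtain ⟨κ, hκ0, hκ1, hκ⟩ := Polyhedron.exists_scale g (f i) hw
    obtain ⟨κ', hκ0', hκ1', hκ'⟩ := Polyhedron.exists_scale g' (f i) hw'
    -- The entry `1 / 2` makes the factor strictly positive, so that domination by the scaled point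
    -- preserves positive coordinates.
    refine ⟨max (1 / 2) (max κ κ'), lt_max_of_lt_left (by norm_num),
      max_lt (by norm_num) (max_lt hκ1 hκ1'), ⟨w, fun u hu => hκ u fun v => ?_⟩,
      ⟨w', fun u hu => hκ' u fun v => ?_⟩⟩
    · exact (mul_le_mul_of_nonneg_right ((le_max_left _ _).trans (le_max_right _ _))
        ((f i).2.1 v)).trans (hu v)
    · exact (mul_le_mul_of_nonneg_right ((le_max_right _ _).trans (le_max_right _ _))
        ((f i).2.1 v)).trans (hu v)
  choose κ hκ0 hκ1 hκg hκg' using hscale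
  choose ρ₁ hρ₁ hρ₁' using fun i => (f i).exists_radius (hκ1 i)
  choose ρ₂ hρ₂ hρ₂' using fun i => (f' i).exists_radius (κ := 1 / 2) (by norm_num)
  -- By compactness of the interval the peak along the path of `i` has a positive minimum. The
  -- vertex `w` may vary with `t`, but the radius does not.
  have hpath : ∀ i, ∃ ρ > 0, ∀ t, ∃ w, ρ ≤ (H (t, i)).1 w := by
    intro i
    have hc : Continuous fun t : unitInterval => peak (H (t, i)).1 :=
      hH.continuous_peak.comp (Continuous.prodMk continuous_id continuous_const)
    obtain ⟨t₀, -, ht₀⟩ := isCompact_univ.exists_isMinOn Set.univ_nonempty hc.continuousOn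
    refine ⟨_, (hH.pt (t₀, i)).peak_pos, fun t => ?_⟩
    obtain ⟨w, hw⟩ := (hH.pt (t, i)).exists_eq_peak
    exact ⟨w, (ht₀ (Set.mem_univ t)).trans hw.ge⟩
  choose ρ₃ hρ₃ hρ₃' using hpath
  -- One family records the coordinates of `f`, of `f'` and of the homotopy at all times. The radii
  -- are small enough that on each `B i` the values of `f` share a vertex, and so do those of `f'`
  -- and those of `H` at each time.
  let A : X → V ⊕ V' ⊕ (unitInterval × W) → ℝ := fun x =>
    Sum.elim (f x).1 (Sum.elim (f' x).1 fun p => (H (p.1, x)).1 p.2)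
  let ρ : X → ℝ := fun i => min (ρ₁ i) (min (ρ₂ i) (ρ₃ i))
  let B : X → Set X := fun i => {x | ∀ a, |A x a - A i a| < ρ i}
  have hB₁ : ∀ i, ∀ x ∈ B i, ∀ v, κ i * (f i).1 v ≤ (f x).1 v := fun i x hx =>
    hρ₁' i (f x) fun v => (hx (.inl v)).trans_le (min_le_left _ _)
  have hB₁' : ∀ i, ∃ v, ∀ x ∈ B i, 0 < (f x).1 v := fun i =>
    let ⟨v, hv⟩ := (f i).exists_pos
    ⟨v, fun x hx => (mul_pos (hκ0 i) hv).trans_le (hB₁ i x hx v)⟩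
  have hB₂ : ∀ i, ∃ v, ∀ x ∈ B i, 0 < (f' x).1 v := by
    intro i
    obtain ⟨v, hv⟩ := (f' i).exists_pos
    refine ⟨v, fun x hx => ?_⟩
    have := hρ₂' i (f' x)
      (fun v => (hx (.inr (.inl v))).trans_le ((min_le_right _ _).trans (min_le_left _ _))) v
    linarith
  have hB₃ : ∀ i t, ∃ w, ∀ x ∈ B i, 0 < (H (t, x)).1 w := by
    intro i t
    obtain ⟨w, hw⟩ := hρ₃' i t
    refine ⟨w, fun x hx => ?_⟩
    have h1 : |(H (t, x)).1 w - (H (t, i)).1 w| < ρ₃ i :=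
      (hx (.inr (.inr (t, w)))).trans_le ((min_le_right _ _).trans (min_le_right _ _))
    linarith [(abs_lt.1 h1).1]
  obtain ⟨φ, hφ, hφB⟩ := exists_coneMap_nerve A
    (by
      rintro x (v | v | ⟨t, w⟩)
      · exact (f x).abs_le_one v
      · exact (f' x).abs_le_one v
      · exact (H (t, x)).abs_le_one w)
    (by
      intro x ε hε
      filter_upwards [hf.eventually_abs_sub_le x hε, hf'.eventually_abs_sub_le x hε,
        hH.eventually_forall_abs_sub_le x hε] with y h1 h2 h3
      rintro (v | v | ⟨t, w⟩)
      · exact h1 v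
      · exact h2 v
      · exact h3 t w)
    ρ (fun i => lt_min (hρ₁ i) (lt_min (hρ₂ i) (hρ₃ i))) (B := B) fun i x hx => hx
  have hN := IsConeMap.of_continuousMap (ContinuousMap.id (Polyhedron (nerve B)))
  have hφN : ∀ x, ∃ i, x ∈ B i ∧ ∀ j, 0 < (hφ.realize x).1 j → j ∈ B i := fun x =>
    let ⟨i, hx, hi⟩ := hφB x
    ⟨i, hx, fun j hj => hi j ((hφ.pt x).pos_of_toPolyhedron_pos hj)⟩
  -- The maps out of the nerve blend the values of `f`, respectively `f'`, at the vertices. A vertex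
  -- common to all values over `B i` makes the blend nonzero, and later makes its composite with the
  -- map of `X` into the nerve homotopic to `f`, respectively `f'`.
  have hΦ := hN.blend (a := fun i _ => (f i).1)
    (fun i => IsConeMap.of_continuousMap (ContinuousMap.const _ (f i))) fun y =>
      let ⟨i, hi⟩ := nerve.exists_forall_mem y
      (hB₁' i).imp fun v hv j hj => hv j (hi j hj)
  have hΦ' := hN.blend (a := fun i _ => (f' i).1)
    (fun i => IsConeMap.of_continuousMap (ContinuousMap.const _ (f' i))) fun y =>
      let ⟨i, hi⟩ := nerve.exists_forall_mem y
      (hB₂ i).imp fun v hv j hj => hv j (hi j hj)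
  -- Blending the paths of the vertices under `H` gives a homotopy between the blends of the vertex
  -- values of `g` and of `g'` after the push. At both ends `blend_common` compares these with `g`
  -- and `g'` applied to the blend of the `f i`.
  have hΛ := (hN.comp (ContinuousMap.snd : C(unitInterval × Polyhedron (nerve B), _))).blend
    (a := fun i p => (H (p.1, i)).1)
    (fun i => hH.comp ⟨fun p : unitInterval × Polyhedron (nerve B) => (p.1, i), by fun_prop⟩) fun p =>
      let ⟨i, hi⟩ := nerve.exists_forall_mem p.2
      (hB₃ i p.1).imp fun v hv j hj => hv j (hi j hj)
  refine ⟨nerve B, hφ.realize, hΦ.realize, hΦ'.realize, ?_, ?_, ?_⟩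
  · refine ((hΦ.comp hφ.realize).homotopic_of_common hf fun x => ?_).trans hrf
    obtain ⟨i, hx, hi⟩ := hφN x
    obtain ⟨v, hv⟩ := hB₁' i
    exact ⟨v, (hφ.realize x).isConePt.blend_pos (fun j => (f j).2.1 v) (fun j => (f j).le_one v)
      fun j hj => hv j (hi j hj), hv x hx⟩
  · refine ((hΦ'.comp hφ.realize).homotopic_of_common hf' fun x => ?_).trans
      (IsConeMap.realize_homotopic f')
    obtain ⟨i, hx, hi⟩ := hφN x
    obtain ⟨v, hv⟩ := hB₂ i
    exact ⟨v, (hφ.realize x).isConePt.blend_pos (fun j => (f' j).2.1 v) (fun j => (f' j).le_one v)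
      fun j hj => hv j (hi j hj), hv x hx⟩
  · have hΛ₀ := hΛ.comp (⟨fun y => (0, y), by fun_prop⟩ :
      C(Polyhedron (nerve B), unitInterval × Polyhedron (nerve B)))
    have hΛ₁ := hΛ.comp (⟨fun y => (1, y), by fun_prop⟩ :
      C(Polyhedron (nerve B), unitInterval × Polyhedron (nerve B)))
    have h₀ := (IsConeMap.of_continuousMap (g.comp hΦ.realize)).homotopic_of_common hΛ₀ fun y => by
      obtain ⟨w, hw, hw'⟩ := blend_common hκ1 hB₁ g hκg y (hΦ.pt y)
      refine ⟨w, hw, ?_⟩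
      have e : (fun i => (H (0, i)).1) = fun i => (g (f i).isConePt.toPolyhedron).1 :=
        funext fun i => by rw [H.apply_zero]; rfl
      change 0 < blend y.1 (fun i => (H (0, i)).1) w
      rw [e]
      exact hw'
    have h₁ := (IsConeMap.of_continuousMap (g'.comp hΦ.realize)).homotopic_of_common hΛ₁ fun y => by
      obtain ⟨w, hw, hw'⟩ := blend_common hκ1 hB₁ g' hκg' y (hΦ.pt y)
      refine ⟨w, hw, ?_⟩
      have e : (fun i => (H (1, i)).1) = fun i => (g' (f i).isConePt.toPolyhedron).1 :=
        funext fun i => by rw [H.apply_one]; rfl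
      change 0 < blend y.1 (fun i => (H (1, i)).1) w
      rw [e]
      exact hw'
    exact (IsConeMap.realize_homotopic _).symm.trans <| h₀.trans <|
      (IsConeMap.homotopic hΛ₀ hΛ₁ hΛ (fun _ => rfl) fun _ => rfl).trans <| h₁.symm.trans <|
        IsConeMap.realize_homotopic _

/-! ## The homotopy category -/

instance : Congruence homotopyRel.{u} where
  equivalence :=
    { refl := fun _ => ContinuousMap.Homotopic.refl _
      symm := fun h => ContinuousMap.Homotopic.symm h
      trans := fun h h' => ContinuousMap.Homotopic.trans h h' }
  comp_left _ _ _ h := ContinuousMap.Homotopic.comp h (ContinuousMap.Homotopic.refl _)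
  comp_right _ h := ContinuousMap.Homotopic.comp (ContinuousMap.Homotopic.refl _) h

theorem toHTop_map_eq_iff {X Y : TopCat.{u}} {f g : X ⟶ Y} :
    toHTop.map f = toHTop.map g ↔ f.hom.Homotopic g.hom :=
  Quotient.functor_map_eq_iff _ f g

theorem hPoly.exists_nerve {X : TopCat.{u}} {V V' W : Type u} {K : PreAbstractSimplicialComplex V}
    {K' : PreAbstractSimplicialComplex V'} {L : PreAbstractSimplicialComplex W}
    (f : toHTop.obj X ⟶ hPoly K) (f' : toHTop.obj X ⟶ hPoly K') (g g' : hPoly K ⟶ hPoly L)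
    (hgg : f ≫ g = f ≫ g') :
    ∃ (N : PreAbstractSimplicialComplex X) (h : toHTop.obj X ⟶ hPoly N) (k : hPoly N ⟶ hPoly K)
      (k' : hPoly N ⟶ hPoly K'), h ≫ k = f ∧ h ≫ k' = f' ∧ k ≫ g = k ≫ g' := by
  obtain ⟨f, rfl⟩ := toHTop.map_surjective f
  obtain ⟨f', rfl⟩ := toHTop.map_surjective f'
  obtain ⟨g, rfl⟩ := toHTop.map_surjective (X := TopCat.of (Polyhedron K))
    (Y := TopCat.of (Polyhedron L)) g
  obtain ⟨g', rfl⟩ := toHTop.map_surjective (X := TopCat.of (Polyhedron K))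
    (Y := TopCat.of (Polyhedron L)) g'
  have hgg' : toHTop.map (f ≫ g) = toHTop.map (f ≫ g') := by
    rw [Functor.map_comp, Functor.map_comp]
    exact hgg
  obtain ⟨N, h, k, k', h₁, h₂, h₃⟩ :=
    _root_.exists_nerve f.hom f'.hom g.hom g'.hom (toHTop_map_eq_iff.1 hgg')
  refine ⟨N, toHTop.map (TopCat.ofHom h), toHTop.map (TopCat.ofHom k),
    toHTop.map (TopCat.ofHom k'), ?_, ?_, ?_⟩
  · exact (toHTop.map_comp _ _).symm.trans (toHTop_map_eq_iff.2 h₁)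
  · exact (toHTop.map_comp _ _).symm.trans (toHTop_map_eq_iff.2 h₂)
  · exact (toHTop.map_comp _ _).symm.trans
      ((toHTop_map_eq_iff.2 h₃).trans (toHTop.map_comp _ _))

/-- The complex with a single vertex. -/
def pointComplex : PreAbstractSimplicialComplex PUnit.{u + 1} where
  faces := {s | s.Nonempty}
  isRelLowerSet_faces := fun _ hs => ⟨hs, fun _ _ ht => ht⟩

theorem pointComplex_dimLE : pointComplex.{u}.DimLE 0 := fun s _ =>
  (Finset.card_le_univ s).trans (by simp)

theorem nonempty_iso_pointComplex :
    Nonempty (toHTop.obj (TopCat.of PUnit.{u + 1}) ≅ hPoly pointComplex.{u}) := by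
  have huniv : (Finset.univ : Finset PUnit.{u + 1}) ∈ pointComplex.faces :=
    ⟨PUnit.unit, Finset.mem_univ _⟩
  let o : Polyhedron pointComplex.{u} := ⟨fun _ => 1, fun _ => zero_le_one, Finset.univ, huniv,
    fun x hx => absurd (Finset.mem_univ x) hx, by simp⟩
  have ho : ∀ t : Polyhedron pointComplex.{u}, t = o := fun t => by
    have h1 := Polyhedron.sum_eq_one_of_mem_simplex (t := t) (s := Finset.univ)
      fun x hx => absurd (Finset.mem_univ x) hx
    refine Subtype.ext (funext fun x => ?_)
    simpa using h1
  let e : PUnit.{u + 1} ≃ₜ Polyhedron pointComplex.{u} :=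
    { toFun := fun _ => o
      invFun := fun _ => PUnit.unit
      left_inv := fun _ => rfl
      right_inv := fun t => (ho t).symm
      continuous_toFun := continuous_const
      continuous_invFun := continuous_const }
  exact ⟨toHTop.mapIso (TopCat.isoOfHomeo (X := TopCat.of PUnit.{u + 1})
    (Y := TopCat.of (Polyhedron pointComplex.{u})) e)⟩

/-! ## Existence of expansions -/

namespace HPolExpansion

variable {X : TopCat.{u}}

/-- The components of a morphism from a space into a system. -/
def singleApp {S : HSystem.{u}} (p : InvSystem.SysHom (InvSystem.single (toHTop.obj X)) S)
    (i : S.Idx) : toHTop.obj X ⟶ S.obj i :=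
  p.app i

/-- In a one-point system passing to a later index changes nothing, so compatibility up to a later
index is strict. -/
theorem singleApp_map {S : HSystem.{u}} (p : InvSystem.SysHom (InvSystem.single (toHTop.obj X)) S)
    {i j : S.Idx} (hij : i ≤ j) :
    singleApp p j ≫ S.map hij = singleApp p i := by
  obtain ⟨l, h₁, h₂, e⟩ := p.comm hij
  have e' : 𝟙 (toHTop.obj X) ≫ singleApp p i =
    𝟙 (toHTop.obj X) ≫ singleApp p j ≫ S.map hij := e
  rw [Category.id_comp, Category.id_comp] at e'
  exact e'.symm

theorem toPro_single_eq_iff {S : HSystem.{u}}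
    {p q : InvSystem.SysHom (InvSystem.single (toHTop.obj X)) S} :
    p.toPro = q.toPro ↔
      ∀ m, singleApp p m = singleApp q m := by
  constructor
  · intro h m
    obtain ⟨l, h₁, h₂, e⟩ := _root_.Quotient.exact h m
    have e' : 𝟙 (toHTop.obj X) ≫ singleApp p m =
      𝟙 (toHTop.obj X) ≫ singleApp q m := e
    rwa [Category.id_comp, Category.id_comp] at e'
  · intro h
    refine _root_.Quotient.sound fun m => ⟨PUnit.unit, le_refl _, le_refl _, ?_⟩
    exact congrArg (fun t : toHTop.obj X ⟶ S.obj m => 𝟙 (toHTop.obj X) ≫ t) (h m)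

/-- A compatible family of H-maps is an expansion if every H-map into HPol factors through a term
of the system, and the factorization is unique after passing to a later term. -/
def ofFactorization (S : HSystem.{u}) (hS : InPolSystem S)
    (p : InvSystem.SysHom (InvSystem.single (toHTop.obj X)) S)
    (hex : ∀ Y : HTop.{u}, IsHPol Y → ∀ h : toHTop.obj X ⟶ Y,
      ∃ (i : S.Idx) (k : S.obj i ⟶ Y), singleApp p i ≫ k = h)
    (huniq : ∀ Y : HTop.{u}, IsHPol Y → ∀ (i : S.Idx) (k k' : S.obj i ⟶ Y),
      singleApp p i ≫ k = singleApp p i ≫ k' →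
      ∃ (j : S.Idx) (h : i ≤ j), S.map h ≫ k = S.map h ≫ k') :
    HPolExpansion X where
  sys := S
  inPol := hS
  p := p.toPro
  univ Y hY := by
    rintro ⟨h⟩
    choose idx app happ using fun m => hex (Y.obj m) (hY m) (singleApp h m)
    let f : InvSystem.SysHom S Y :=
      { idx := idx
        app := app
        comm := by
          intro m m' hm
          -- The chosen factorizations need not be compatible. After restriction to a common index
          -- they agree on `X`, and `huniq` makes them agree at a later term.
          obtain ⟨c, hc, hc'⟩ := exists_ge_ge (idx m) (idx m')
          obtain ⟨d, hd, e⟩ := huniq (Y.obj m) (hY m) c (S.map hc ≫ app m)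
            (S.map hc' ≫ app m' ≫ Y.map hm) (by
              rw [← Category.assoc, singleApp_map, happ, ← Category.assoc, singleApp_map, ← Category.assoc,
                happ]
              exact (singleApp_map h hm).symm)
          refine ⟨d, hc.trans hd, hc'.trans hd, ?_⟩
          rwa [InvSystem.map_trans_assoc, InvSystem.map_trans_assoc] at e }
    refine ⟨f.toPro, toPro_single_eq_iff.2 happ, ?_⟩
    rintro ⟨g⟩ hg
    have hg' := toPro_single_eq_iff.1
      (show (p.comp g).toPro = InvSystem.SysHom.toPro h from hg)
    refine _root_.Quotient.sound fun m => ?_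
    obtain ⟨c, hc, hc'⟩ := exists_ge_ge (g.idx m) (idx m)
    obtain ⟨d, hd, e⟩ := huniq (Y.obj m) (hY m) c (S.map hc ≫ g.app m) (S.map hc' ≫ app m) (by
      rw [← Category.assoc, singleApp_map, ← Category.assoc, singleApp_map, happ]
      exact hg' m)
    refine ⟨d, hc.trans hd, hc'.trans hd, ?_⟩
    rwa [InvSystem.map_trans_assoc, InvSystem.map_trans_assoc] at e

end HPolExpansion

/-- An H-map from `X` into a polyhedron with vertices in `X`. -/
structure PolyArrow (X : TopCat.{u}) : Type u where
  cx : PreAbstractSimplicialComplex X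
  map : toHTop.obj X ⟶ hPoly cx

namespace PolyArrow

variable {X : TopCat.{u}}

/-- Morphisms `P ⟶ Q` are H-maps from the polyhedron of `Q` to that of `P` under `X`. -/
instance : SmallCategory (PolyArrow X) where
  Hom P Q := {k : hPoly Q.cx ⟶ hPoly P.cx // Q.map ≫ k = P.map}
  id P := ⟨𝟙 _, Category.comp_id _⟩
  comp k l := ⟨l.1 ≫ k.1, by rw [← Category.assoc, l.2, k.2]⟩
  id_comp k := Subtype.ext (Category.comp_id _)
  comp_id k := Subtype.ext (Category.id_comp _)
  assoc k l m := Subtype.ext (Category.assoc _ _ _).symm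

/-- Both conditions are instances of `hPoly.exists_nerve`: a common nerve dominates two objects, and
a nerve on which `k` and `l` already agree equalizes them. -/
instance : IsFiltered (PolyArrow X) where
  cocone_objs P Q := by
    obtain ⟨N, h, k, k', hk, hk', -⟩ := hPoly.exists_nerve P.map Q.map (𝟙 _) (𝟙 _) rfl
    exact ⟨⟨N, h⟩, ⟨k, hk⟩, ⟨k', hk'⟩, trivial⟩
  cocone_maps P Q k l := by
    obtain ⟨N, h, m, -, hm, -, e⟩ :=
      hPoly.exists_nerve Q.map Q.map k.1 l.1 (k.2.trans l.2.symm)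
    exact ⟨⟨N, h⟩, ⟨m, hm⟩, Subtype.ext e⟩
  nonempty := by
    obtain ⟨e⟩ := nonempty_iso_pointComplex.{u}
    let f : toHTop.obj X ⟶ hPoly pointComplex.{u} :=
      toHTop.map (TopCat.ofHom (ContinuousMap.const X PUnit.unit)) ≫ e.hom
    obtain ⟨N, h, -⟩ := hPoly.exists_nerve f f (𝟙 _) (𝟙 _) rfl
    exact ⟨⟨N, h⟩⟩

end PolyArrow

/-- Every topological space has an HPol-expansion. -/
theorem HPolExpansion.nonempty (X : TopCat.{u}) : Nonempty (HPolExpansion X) := by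
  -- Systems are indexed by directed sets, so the filtered category is replaced by a directed set
  -- with a final functor to it.
  obtain ⟨α, _, _, _, F, hF⟩ := IsFiltered.exists_directed (PolyArrow X)
  obtain ⟨hF₁, hF₂⟩ := (Functor.final_iff_of_isFiltered F).1 hF
  let S : HSystem.{u} :=
    { Idx := α
      obj := fun a => hPoly (F.obj a).cx
      map := fun h => (F.map (homOfLE h)).1
      map_refl := fun a => congrArg Subtype.val (F.map_id a)
      map_trans := fun h h' =>
        (congrArg Subtype.val (F.map_comp (homOfLE h) (homOfLE h'))).symm }
  let p : InvSystem.SysHom (InvSystem.single (toHTop.obj X)) S :=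
    { idx := fun _ => PUnit.unit
      app := fun a => (F.obj a).map
      comm := fun h => ⟨PUnit.unit, le_refl _, le_refl _,
        congrArg (fun t => 𝟙 (toHTop.obj X) ≫ t) (F.map (homOfLE h)).2.symm⟩ }
  refine ⟨ofFactorization S (fun a => ⟨_, _, ⟨Iso.refl _⟩⟩) p ?_ ?_⟩
  · rintro Y ⟨V, K, ⟨e⟩⟩ f
    -- The vertex set `V` is unrelated to `X`; passing to a nerve moves the factorization into a
    -- polyhedron with vertices in `X`.
    obtain ⟨N, h, k, -, hk, -, -⟩ := hPoly.exists_nerve (f ≫ e.hom) (f ≫ e.hom) (𝟙 _) (𝟙 _) rfl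
    obtain ⟨a, ⟨l⟩⟩ := hF₁ ⟨N, h⟩
    refine ⟨a, l.1 ≫ k ≫ e.inv, ?_⟩
    change (F.obj a).map ≫ l.1 ≫ k ≫ e.inv = f
    have hl : (F.obj a).map ≫ l.1 = h := l.2
    rw [← Category.assoc, hl, ← Category.assoc, hk, Category.assoc, e.hom_inv_id,
      Category.comp_id]
  · rintro Y ⟨V, K, ⟨e⟩⟩ a k k' hkk
    have hkk' : (F.obj a).map ≫ k ≫ e.hom = (F.obj a).map ≫ k' ≫ e.hom := by
      rw [← Category.assoc, ← Category.assoc]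
      exact congrArg (fun t => t ≫ e.hom) hkk
    obtain ⟨N, h, m, -, hm, -, hmk⟩ :=
      hPoly.exists_nerve (F.obj a).map (F.obj a).map (k ≫ e.hom) (k' ≫ e.hom) hkk'
    have hmk' : m ≫ k = m ≫ k' := by
      rw [← cancel_mono e.hom, Category.assoc, Category.assoc]
      exact hmk
    obtain ⟨b, ⟨l⟩⟩ := hF₁ ⟨N, h⟩
    obtain ⟨c, hac, hbc⟩ := exists_ge_ge a b
    let q : F.obj a ⟶ (⟨N, h⟩ : PolyArrow X) := ⟨m, hm⟩
    -- Finality equalizes the bonding morphism from `a` to `c` with the detour through `N`. The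
    -- bonding map from `d` to `a` therefore factors through `m`, on which `k` and `k'` agree.
    obtain ⟨d, t, ht⟩ := hF₂ (F.map (homOfLE hac)) (q ≫ l ≫ F.map (homOfLE hbc))
    refine ⟨d, hac.trans (leOfHom t), ?_⟩
    have e₁ : F.map (homOfLE (hac.trans (leOfHom t))) =
        q ≫ l ≫ F.map (homOfLE hbc) ≫ F.map t := by
      rw [Category.assoc, Category.assoc] at ht
      rw [← ht, ← F.map_comp]
      rfl
    have e₂ : ∃ n : hPoly (F.obj d).cx ⟶ hPoly N,
        (F.map (homOfLE (hac.trans (leOfHom t)))).1 = n ≫ m :=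
      ⟨_, congrArg Subtype.val e₁⟩
    obtain ⟨n, hn⟩ := e₂
    change (F.map (homOfLE (hac.trans (leOfHom t)))).1 ≫ k =
      (F.map (homOfLE (hac.trans (leOfHom t)))).1 ≫ k'
    rw [hn, Category.assoc, hmk', Category.assoc]

/-! ## Shape dimension of composites -/

/-- Each component of the composite passes through a term of `B`, where the identity can be replaced
by the domination `i ≫ r`. No later index is needed. -/
theorem ProHomDimLE.of_systemDimLE {A B C : HSystem.{u}} {n : ℕ} (hB : SystemDimLE B n)
    (f : A ⟶ B) (g : B ⟶ C) : ProHomDimLE (f ≫ g) n := by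
  obtain ⟨f⟩ := f
  obtain ⟨g⟩ := g
  refine ⟨f.comp g, rfl, fun m => ⟨_, le_refl _, ?_⟩⟩
  obtain ⟨V, K, hK, i, r, hir⟩ := hB (g.idx m)
  refine ⟨V, K, hK, A.map (le_refl _) ≫ f.app (g.idx m) ≫ i, r ≫ g.app m, ?_⟩
  have e : f.app (g.idx m) ≫ g.app m = (f.app (g.idx m) ≫ i) ≫ r ≫ g.app m := by
    rw [Category.assoc, ← Category.assoc i r, hir, Category.id_comp]
  exact (congrArg (fun t => A.map (le_refl (f.idx (g.idx m))) ≫ t) e).trans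
    (Category.assoc _ _ _).symm

/-- The expansions of `Z` that occur in `G` and `H` may have large dimension, but the canonical
morphism between them factors through the expansion `a` of dimension `≤ n`. -/
theorem ShapeSdLE.comp {X Y Z : TopCat.{u}} {n : ℕ} (hZ : SpaceSdLE Z n) (G : ShapeHom X Z)
    (H : ShapeHom Z Y) : ShapeSdLE (G.comp H) n := by
  obtain ⟨a, ha⟩ := hZ
  obtain ⟨r⟩ := G
  obtain ⟨s⟩ := H
  refine ⟨⟨r.dom, s.cod, r.hom ≫ r.cod.can s.dom ≫ s.hom⟩, rfl, ?_⟩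
  have e : r.hom ≫ r.cod.can s.dom ≫ s.hom = (r.hom ≫ r.cod.can a) ≫ a.can s.dom ≫ s.hom := by
    rw [← HPolExpansion.can_can r.cod a s.dom]
    simp only [Category.assoc]
  change ProHomDimLE (r.hom ≫ r.cod.can s.dom ≫ s.hom) n
  rw [e]
  exact ProHomDimLE.of_systemDimLE ha _ _

/-! ### Shape images of H-maps and maps through a point -/

theorem InvSystem.singleMap_comp {X Y Z : HTop.{u}} (f : X ⟶ Y) (g : Y ⟶ Z) :
    (InvSystem.singleMap (f ≫ g) : (InvSystem.single X : HSystem.{u}) ⟶ InvSystem.single Z) =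
      InvSystem.singleMap f ≫ InvSystem.singleMap g :=
  rfl

/-- The shape functor is defined on every H-map. -/
theorem exists_isShapeImage {X Y : TopCat.{u}} (f : toHTop.obj X ⟶ toHTop.obj Y) :
    ∃ F : ShapeHom X Y, IsShapeImage f F := by
  obtain ⟨a⟩ := HPolExpansion.nonempty X
  obtain ⟨b⟩ := HPolExpansion.nonempty Y
  obtain ⟨k, hk, -⟩ := a.univ b.sys b.inPol (InvSystem.singleMap f ≫ b.p)
  exact ⟨_, ⟨a, b, k⟩, rfl, hk⟩

theorem IsShapeImage.comp {X Y Z : TopCat.{u}} {g : toHTop.obj X ⟶ toHTop.obj Z}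
    {h : toHTop.obj Z ⟶ toHTop.obj Y} {G : ShapeHom X Z} {H : ShapeHom Z Y}
    (hg : IsShapeImage g G) (hh : IsShapeImage h H) : IsShapeImage (g ≫ h) (G.comp H) := by
  obtain ⟨r, rfl, hr⟩ := hg
  obtain ⟨s, rfl, hs⟩ := hh
  refine ⟨⟨r.dom, s.cod, r.hom ≫ r.cod.can s.dom ≫ s.hom⟩, rfl, ?_⟩
  change r.dom.p ≫ r.hom ≫ r.cod.can s.dom ≫ s.hom = InvSystem.singleMap (g ≫ h) ≫ s.cod.p
  rw [InvSystem.singleMap_comp, Category.assoc, ← hs, ← Category.assoc, hr, Category.assoc,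
    ← Category.assoc r.cod.p, HPolExpansion.p_can]

theorem HMapSdLE.comp {X Y Z : TopCat.{u}} {n : ℕ} (hZ : SpaceSdLE Z n)
    (g : toHTop.obj X ⟶ toHTop.obj Z) (h : toHTop.obj Z ⟶ toHTop.obj Y) :
    HMapSdLE (g ≫ h) n := by
  obtain ⟨G, hG⟩ := exists_isShapeImage g
  obtain ⟨H, hH⟩ := exists_isShapeImage h
  exact ⟨G.comp H, hG.comp hH, ShapeSdLE.comp hZ G H⟩

/-- A point is itself a polyhedron, so its identity is an expansion with a single term. -/
theorem spaceSdLE_punit : SpaceSdLE (TopCat.of PUnit.{u + 1}) 0 := by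
  obtain ⟨e⟩ := nonempty_iso_pointComplex.{u}
  refine ⟨{ sys := InvSystem.single (toHTop.obj (TopCat.of PUnit.{u + 1}))
            inPol := fun _ => ⟨_, _, ⟨e⟩⟩
            p := 𝟙 _
            univ := fun Y _ h => ⟨h, Category.id_comp h, fun k hk => ?_⟩ }, fun _ => ?_⟩
  · exact (Category.id_comp k).symm.trans hk
  · exact ⟨_, _, pointComplex_dimLE, e.hom, e.inv, e.hom_inv_id⟩

/-- The factorization through a point holds only up to homotopy, so the estimate is applied to
H-maps rather than to continuous maps. -/
theorem MapSdLE.of_nullhomotopic {X Y : TopCat.{u}} {f : X ⟶ Y} (hf : f.hom.Nullhomotopic) :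
    MapSdLE f 0 := by
  obtain ⟨y, hy⟩ := hf
  let c : X ⟶ TopCat.of PUnit.{u + 1} := TopCat.ofHom (ContinuousMap.const X PUnit.unit)
  let d : TopCat.of PUnit.{u + 1} ⟶ Y := TopCat.ofHom (ContinuousMap.const _ y)
  have e : toHTop.map f = toHTop.map c ≫ toHTop.map d :=
    (toHTop_map_eq_iff.2 hy : toHTop.map f = toHTop.map (c ≫ d)).trans (toHTop.map_comp c d)
  unfold MapSdLE
  rw [e]
  exact HMapSdLE.comp spaceSdLE_punit _ _

theorem corollary2 :
    (∀ (X Y Z : TopCat.{u}) (n : ℕ) (F : ShapeHom X Y),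
      SpaceSdLE Z n →
      (∃ (G : ShapeHom X Z) (H : ShapeHom Z Y), F = G.comp H) →
      ShapeSdLE F n) ∧
    (∀ (X Y Z : TopCat.{u}) (n : ℕ) (f : X ⟶ Y),
      SpaceSdLE Z n →
      (∃ (g : X ⟶ Z) (h : Z ⟶ Y), f = g ≫ h) →
      MapSdLE f n) ∧
    (∀ (X Y : TopCat.{u}) (f : X ⟶ Y),
      f.hom.Nullhomotopic → MapSdEq f 0) := by
  refine ⟨?_, ?_, ?_⟩
  · rintro X Y Z n _ hZ ⟨G, H, rfl⟩
    exact ShapeSdLE.comp hZ G H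
  · rintro X Y Z n _ hZ ⟨g, h, rfl⟩
    unfold MapSdLE
    rw [Functor.map_comp]
    exact HMapSdLE.comp hZ _ _
  · intro X Y f hf
    exact ⟨MapSdLE.of_nullhomotopic hf, fun _ _ => Nat.zero_le _⟩
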